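/- Let $G$ be a finite simple bipartite graph on the vertex set $[d]=\{1,\dots,d\}$ with a bipartition $[d]=V_1\sqcup V_2$ (parts may be empty, and isolated vertices are allowed), and let $\widehat G$ be the connected bipartite graph on $[d+2]$ with edge set $$E(\widehat G)=E(G)\cup\{\{i,d+1\}: i\in V_1\}\cup\{\{j,d+2\}: j\in V_2\cup\{d+1\}\}.$$ For a hypergraph $\mathcal H=(V,E)$, where $V$ is a finite set and $E=\{e_1,\dots,e_n\}$ is a finite multiset of non-empty subsets of $V$, let $\mathrm{Bip}\,\mathcal H$ be the bipartite graph on $V\sqcup E$ in which $v\in V$ and $e\in E$ are adjacent if and only if $v\in e$. A hypertree of $\mathcal H$ is a function $\mathbf f:E\to\{0,1,\dots\}$ for which some spanning tree of $\mathrm{Bip}\,\mathcal H$ has degree $\mathbf f(e)+1$ at every $e\in E$. A hyperedge $e_j$ is internally inactive with respect to a hypertree $\mathbf f$ if for some $j'<j$ the function obtained from $\mathbf f$ by decreasing $\mathbf f(e_j)$ by $1$ and increasing $\mathbf f(e_{j'})$ by $1$ is again a hypertree. Let $\overline\iota(\mathbf f)$ be the number of internally inactive hyperedges with respect to $\mathbf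 f$. The interior polynomial of $\mathcal H$ is $I_{\mathcal H}(x)=\sum_{\mathbf f}x^{\overline\iota(\mathbf f)}$, the sum over all hypertrees of $\mathcal H$; if $\mathrm{Bip}\,\mathcal H$ is isomorphic to a connected bipartite graph $K$, one sets $I_K(x)=I_{\mathcal H}(x)$. A $k$-matching of $G$ is a set of $k$ pairwise disjoint edges of $G$. Let $M(G,k)$ be the set of all subsets of $[d]$ that are the vertex set (the set of endpoints of the edges) of some $k$-matching of $G$; in particular $M(G,0)=\{\emptyset\}$. Then $$I_{\widehat G}(x)=\sum_{k\ge 0}|M(G,k)|\,x^k .$$ That is, for every hypergraph $\mathcal H$ with $\mathrm{Bip}\,\mathcal H\cong\widehat G$ and every ordering of its hyperedges, $I_{\mathcal H}(x)=\sum_{k\ge0}|M(G,k)|\,x^k$. -/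

import Mathlib

open Polynomial

/-- A hypergraph with vertex set `α`, whose multiset of non-empty hyperedges is given as a family
indexed by `ε` (so equal hyperedges may occur for different indices). -/
structure MultiHypergraph (α ε : Type*) where
  /-- The set of vertices of a hyperedge. -/
  edge : ε → Set α
  /-- Hyperedges are non-empty. -/
  edge_nonempty : ∀ e, (edge e).Nonempty

namespace MultiHypergraph

variable {α ε : Type*}

/-- The bipartite graph `Bip H` on the disjoint union of vertices and hyperedges, where a vertex is
joined to the hyperedges that contain it. -/
def bip (H : MultiHypergraph α ε) : SimpleGraph (α ⊕ ε) :=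
  SimpleGraph.fromEdgeSet {s | ∃ v e, v ∈ H.edge e ∧ s = s(Sum.inl v, Sum.inr e)}

/-- `Γ` is a spanning tree of `Bip H` that induces `f`: it has degree `f e + 1` at each
hyperedge `e`. -/
def Induces (H : MultiHypergraph α ε) (Γ : SimpleGraph (α ⊕ ε)) (f : ε → ℕ) : Prop :=
  Γ ≤ H.bip ∧ Γ.IsTree ∧ ∀ e, (Γ.neighborSet (Sum.inr e)).ncard = f e + 1

/-- The set of hypertrees of `H`. -/
def hypertrees (H : MultiHypergraph α ε) : Set (ε → ℕ) :=
  {f | ∃ Γ : SimpleGraph (α ⊕ ε), H.Induces Γ f}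

theorem hypertrees_finite [Finite α] [Finite ε] (H : MultiHypergraph α ε) :
    H.hypertrees.Finite := by
  refine Set.Finite.subset
    (Set.Finite.pi' fun _ : ε => Set.finite_Iic (Nat.card (α ⊕ ε))) ?_
  rintro f ⟨Γ, -, -, h⟩ e
  have h1 : (Γ.neighborSet (Sum.inr e)).ncard ≤ Nat.card (α ⊕ ε) := Set.ncard_le_card _
  have h2 := h e
  exact Set.mem_Iic.2 (by omega)

/-- The hyperedge `e` is internally inactive with respect to `f`: for some smaller hyperedge `e'`,
decreasing `f e` by one and increasing `f e'` by one gives another hypertree `g`. -/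
def InternallyInactive [LinearOrder ε] (H : MultiHypergraph α ε) (f : ε → ℕ) (e : ε) : Prop :=
  ∃ e' < e, ∃ g ∈ H.hypertrees,
    g e + 1 = f e ∧ g e' = f e' + 1 ∧ ∀ e'', e'' ≠ e → e'' ≠ e' → g e'' = f e''

/-- The interior polynomial of `H`, with respect to the given ordering of the hyperedges. -/
noncomputable def interiorPolynomial [Finite α] [Finite ε] [LinearOrder ε]
    (H : MultiHypergraph α ε) : ℤ[X] :=
  ∑ f ∈ H.hypertrees_finite.toFinset, X ^ {e | H.InternallyInactive f e}.ncard

end MultiHypergraph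

/-- The graph `Ĝ` for a bipartite graph `G` with parts `V₁` and `V₂`. For `V = [d]`, the two new
vertices `inr 0` and `inr 1` are `d + 1` and `d + 2`. -/
def hatGraph {V : Type*} (G : SimpleGraph V) (V₁ V₂ : Set V) : SimpleGraph (V ⊕ Fin 2) :=
  SimpleGraph.fromEdgeSet
    (Sym2.map Sum.inl '' G.edgeSet ∪
      {s | ∃ i ∈ Sum.inl '' V₁, s = s(i, Sum.inr 0)} ∪
      {s | ∃ j ∈ Sum.inl '' V₂ ∪ {Sum.inr 0}, s = s(j, Sum.inr 1)})

/-- The set `M(G, k)` of vertex sets of `k`-matchings of `G`. -/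
def matchingVertexSets {V : Type*} (G : SimpleGraph V) (k : ℕ) : Set (Set V) :=
  {S | ∃ M : G.Subgraph, M.IsMatching ∧ M.edgeSet.ncard = k ∧ M.verts = S}

/-!
The interior polynomial does not depend on the order of the hyperedges: by the exchange property,
every vector that lies below a hypertree lies below a unique one to which it can be raised along
internally active hyperedges only, so the polynomial is determined by the numbers of vectors that
are reached from hypertrees by lowering coordinates by `k` in total.

If `Bip H ≅ Ĝ`, then (up to interchanging the two parts) some vertex `s` lies in all hyperedges
and some hyperedge `r` contains all vertices. Joining `s` to all hyperedges and every other vertex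
to one hyperedge gives a spanning tree, so the hypertrees are the fibre counts of the choices of a
hyperedge for every vertex other than `s`. If `r` is the smallest hyperedge, a hyperedge other
than `r` is internally inactive exactly when its value is positive, since one of its vertices may
move to `r`. Hence the hypertrees are to be counted by their support `T` outside `r`.

For fixed `T` they are the vectors of positive sizes of disjoint packings of vertices into the
members of `T`, and these are equinumerous with the sets `S` of vertices that are matched to `T`.
Namely, let the choices of the vertices have generic costs. By linear programming duality each
packing vector is supported by a unique system of prices on `T`, and by genericity as many
vertices as `T` has members are then undecided between several best choices. They form a set `S`
that is matched to `T`, and each such `S` arises once. Finally, the sets `S ∪ T` are the vertex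
sets of the matchings of `G`.
-/

section ExchangeSets

variable {ε : Type*}

/-- The vector `g` arises from `f` by moving one unit from the index `e` to the index `e'`. -/
def IsTransfer (f g : ε → ℕ) (e e' : ε) : Prop :=
  g e + 1 = f e ∧ g e' = f e' + 1 ∧ ∀ e'', e'' ≠ e → e'' ≠ e' → g e'' = f e''

/-- The exchange property of the set of lattice points of an integral base polytope, with the two
points of a pair playing different roles. -/
def HasExchange (P : Set (ε → ℕ)) : Prop :=
  ∀ f ∈ P, ∀ f' ∈ P, ∀ e', f e' < f' e' → ∃ e, f' e < f e ∧ ∃ g ∈ P, IsTransfer f g e e'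

/-- The indices that are internally inactive at a point `f` of a set `P` of integer vectors. -/
def inactive [LinearOrder ε] (P : Set (ε → ℕ)) (f : ε → ℕ) : Set ε :=
  {e | ∃ e' < e, ∃ g ∈ P, IsTransfer f g e e'}

/-- The integer vectors that are reached from `P` by lowering coordinates by `k` in total. -/
def lowerings (P : Set (ε → ℕ)) (k : ℕ) : Set (ε → ℤ) :=
  {g | ∃ f ∈ P, ∃ h : ε →₀ ℕ, h.degree = k ∧ ∀ e, g e + h e = f e}

theorem IsTransfer.sum_eq [Fintype ε] {f g : ε → ℕ} {e e' : ε} (h : IsTransfer f g e e') :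
    ∑ x, g x = ∑ x, f x := by
  classical
  obtain ⟨he, he', hx⟩ := h
  have heq : g + Pi.single e 1 = f + Pi.single e' 1 := by
    ext x
    rcases eq_or_ne x e with rfl | hxe <;> rcases eq_or_ne x e' with rfl | hxe' <;>
      simp_all
    omega
  simpa [Finset.sum_add_distrib] using congrArg (fun u : ε → ℕ => ∑ x, u x) heq

theorem HasExchange.sum_eq [Fintype ε] {P : Set (ε → ℕ)} (hP : HasExchange P) {f f' : ε → ℕ}
    (hf : f ∈ P) (hf' : f' ∈ P) : ∑ e, f e = ∑ e, f' e := by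
  induction hn : ∑ e, (f' e - f e) using Nat.strong_induction_on generalizing f with
  | _ n ih =>
  subst hn
  by_cases hle : f' ≤ f
  · refine Finset.sum_congr rfl fun e _ => ?_
    by_contra hne
    obtain ⟨e', he', -⟩ := hP f' hf' f hf e ((hle e).lt_of_ne' hne)
    exact he'.not_ge (hle e')
  obtain ⟨e', he'⟩ : ∃ e', f e' < f' e' := by simpa [Pi.le_def] using hle
  obtain ⟨e, he, g, hg, ht⟩ := hP f hf f' hf' e' he'
  rw [← ht.sum_eq]
  refine ih _ (Finset.sum_lt_sum (fun x _ => ?_) ⟨e', Finset.mem_univ _, ?_⟩) hg rfl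
  · have := ht.1
    rcases eq_or_ne x e with rfl | hxe
    · omega
    rcases eq_or_ne x e' with rfl | hxe'
    · have := ht.2.1
      omega
    · rw [ht.2.2 x hxe hxe']
  · have := ht.2.1
    omega

theorem toLex_lt_toLex_of_isTransfer [LinearOrder ε] [WellFoundedLT ε] {f g : ε → ℕ} {e e' : ε}
    (h : IsTransfer f g e e') (he : e' < e) : toLex f < toLex g :=
  ⟨e', fun _ hi => (h.2.2 _ (hi.trans he).ne hi.ne).symm, (Nat.lt_succ_self _).trans_eq h.2.1.symm⟩

theorem exists_active_upper_bound [LinearOrder ε] [WellFoundedLT ε] {P : Set (ε → ℕ)}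
    (hP : P.Finite) {f : ε → ℕ} {g : ε → ℤ} (hf : f ∈ P) (hgf : ∀ e, g e ≤ f e) :
    ∃ f' ∈ P, (∀ e, g e ≤ f' e) ∧ ∀ e, g e < f' e → e ∉ inactive P f' := by
  obtain ⟨f', ⟨hf', hgf'⟩, hmax⟩ := (hP.subset (Set.sep_subset P fun f => ∀ e, g e ≤ f e))
    |>.exists_maximalFor toLex _ ⟨f, hf, hgf⟩
  refine ⟨f', hf', hgf', fun e he ⟨e', hlt, f'', hf'', ht⟩ => ?_⟩
  have hgf'' (x : ε) : g x ≤ f'' x := by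
    have := hgf' x
    rcases eq_or_ne x e with rfl | hxe
    · have := ht.1
      omega
    rcases eq_or_ne x e' with rfl | hxe'
    · have := ht.2.1
      omega
    · rwa [ht.2.2 x hxe hxe']
  have hlex := toLex_lt_toLex_of_isTransfer ht hlt
  exact hlex.not_ge (hmax ⟨hf'', hgf''⟩ hlex.le)

theorem eq_of_active_upper_bounds [LinearOrder ε] [WellFoundedLT ε] {P : Set (ε → ℕ)}
    (hP : HasExchange P) {f f' : ε → ℕ} {g : ε → ℤ} (hf : f ∈ P) (hf' : f' ∈ P)
    (hgf : ∀ e, g e ≤ f e) (hgf' : ∀ e, g e ≤ f' e)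
    (hact : ∀ e, g e < f e → e ∉ inactive P f) (hact' : ∀ e, g e < f' e → e ∉ inactive P f') :
    f = f' := by
  have not_lex_lt {f f' : ε → ℕ} (hf : f ∈ P) (hf' : f' ∈ P) (hgf' : ∀ e, g e ≤ f' e)
      (hact : ∀ e, g e < f e → e ∉ inactive P f) : ¬ toLex f < toLex f' := by
    rintro ⟨m, heq, hlt⟩
    obtain ⟨e, he, g', hg', ht⟩ := hP f hf f' hf' m hlt
    have hme : m < e := by
      by_contra! hem
      rcases hem.lt_or_eq with hem | rfl
      · exact he.ne' (heq e hem)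
      · exact he.asymm hlt
    exact hact e ((hgf' e).trans_lt (by exact_mod_cast he)) ⟨m, hme, g', hg', ht⟩
  exact toLex.injective
    ((not_lt.1 (not_lex_lt hf' hf hgf hact')).antisymm (not_lt.1 (not_lex_lt hf hf' hgf' hact)))

theorem exists_active_lowering [LinearOrder ε] [Finite ε] {P : Set (ε → ℕ)} (hP : P.Finite)
    (hex : HasExchange P) {k : ℕ} {g : ε → ℤ} (hg : g ∈ lowerings P k) :
    ∃ f ∈ P, ∃ h : ε →₀ ℕ, h.degree = k ∧ (∀ e, 0 < h e → e ∉ inactive P f) ∧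
      ∀ e, g e + h e = f e := by
  have := Fintype.ofFinite ε
  obtain ⟨f₀, hf₀, h₀, hh₀, hg⟩ := hg
  have hle (e : ε) : g e ≤ f₀ e := by have := hg e; omega
  obtain ⟨f, hf, hgf, hact⟩ := exists_active_upper_bound hP hf₀ hle
  let h : ε →₀ ℕ := Finsupp.equivFunOnFinite.symm fun e => (f e - g e).toNat
  have hh (e : ε) : g e + h e = f e := by
    have := hgf e
    simp only [h, Finsupp.equivFunOnFinite_symm_apply_apply]
    omega
  refine ⟨f, hf, h, ?_, fun e he => hact e (by have := hh e; omega), hh⟩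
  have hsum : ∑ e, (f e : ℤ) = ∑ e, (f₀ e : ℤ) := by exact_mod_cast hex.sum_eq hf hf₀
  simp only [← hh, ← hg, Finset.sum_add_distrib, add_right_inj] at hsum
  rw [← hh₀, Finsupp.degree_eq_sum, Finsupp.degree_eq_sum]
  exact_mod_cast hsum

open Finset in
theorem ncard_lowerings [LinearOrder ε] [Finite ε] {P : Set (ε → ℕ)} (hP : P.Finite)
    (hex : HasExchange P) (k : ℕ) :
    (lowerings P k).ncard =
      ∑ f ∈ hP.toFinset, #(finsuppAntidiag (inactive P f)ᶜ.toFinite.toFinset k) := by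
  have := Fintype.ofFinite ε
  let D := hP.toFinset.sigma fun f => finsuppAntidiag (inactive P f)ᶜ.toFinite.toFinset k
  let lower (p : Σ _ : ε → ℕ, ε →₀ ℕ) (e : ε) : ℤ := p.1 e - p.2 e
  have mem_D {f : ε → ℕ} {h : ε →₀ ℕ} :
      ⟨f, h⟩ ∈ D ↔ f ∈ P ∧ h.degree = k ∧ ∀ e, 0 < h e → e ∉ inactive P f := by
    simp only [D, mem_sigma, mem_finsuppAntidiag', hP.mem_toFinset]
    simp [Finsupp.degree_apply, Finsupp.sum, subset_iff, pos_iff_ne_zero]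
  have hinj : Set.InjOn lower D := by
    rintro ⟨f, h⟩ hp ⟨f', h'⟩ hp' heq
    obtain ⟨hf, -, hh⟩ := mem_D.1 hp
    obtain ⟨hf', -, hh'⟩ := mem_D.1 hp'
    have heq' (e : ε) : (f e : ℤ) - h e = f' e - h' e := congrFun heq e
    obtain rfl : f = f' := eq_of_active_upper_bounds hex (g := lower ⟨f, h⟩) hf hf'
      (fun e => by simp only [lower]; omega) (fun e => by have := heq' e; simp only [lower]; omega)
      (fun e he => hh e (by simp only [lower] at he; omega))
      (fun e he => hh' e (by have := heq' e; simp only [lower] at he; omega))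
    obtain rfl : h = h' := Finsupp.ext fun e => by have := heq' e; omega
    rfl
  have himage : lower '' D = lowerings P k := by
    ext g
    constructor
    · rintro ⟨⟨f, h⟩, hp, rfl⟩
      obtain ⟨hf, hh, -⟩ := mem_D.1 hp
      exact ⟨f, hf, h, hh, fun e => sub_add_cancel _ _⟩
    · intro hg
      obtain ⟨f, hf, h, hh, hact, hgh⟩ := exists_active_lowering hP hex hg
      exact ⟨⟨f, h⟩, mem_D.2 ⟨hf, hh, hact⟩, funext fun e => sub_eq_of_eq_add (hgh e).symm⟩
  rw [← himage, hinj.ncard_image, Set.ncard_coe_finset, card_sigma]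

theorem mk_card_finsuppAntidiag_eq [DecidableEq ε] (D : Finset ε) :
    (PowerSeries.mk fun k => ((Finset.finsuppAntidiag D k).card : ℤ)) =
      PowerSeries.mk 1 ^ D.card := by
  ext k
  rw [← Finset.prod_const, PowerSeries.coeff_prod, PowerSeries.coeff_mk]
  simp

theorem mk_ncard_lowerings_mul [LinearOrder ε] [Fintype ε] {P : Set (ε → ℕ)} (hP : P.Finite)
    (hex : HasExchange P) :
    PowerSeries.mk (fun k => ((lowerings P k).ncard : ℤ)) * (1 - PowerSeries.X) ^ Fintype.card ε =
      ∑ f ∈ hP.toFinset, (1 - PowerSeries.X) ^ (inactive P f).ncard := by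
  have hmk : PowerSeries.mk (fun k => ((lowerings P k).ncard : ℤ)) =
      ∑ f ∈ hP.toFinset, PowerSeries.mk 1 ^ (inactive P f)ᶜ.ncard := by
    ext k
    simp only [PowerSeries.coeff_mk, ncard_lowerings hP hex, Nat.cast_sum, map_sum,
      Set.ncard_eq_toFinset_card _ (Set.toFinite _), ← mk_card_finsuppAntidiag_eq]
  rw [hmk, Finset.sum_mul]
  refine Finset.sum_congr rfl fun f _ => ?_
  rw [← Nat.card_eq_fintype_card, ← Set.ncard_add_ncard_compl (inactive P f), add_comm, pow_add,
    ← mul_assoc, ← mul_pow, PowerSeries.mk_one_mul_one_sub_eq_one, one_pow, one_mul]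

theorem sum_X_pow_ncard_inactive_eq [Finite ε] {P : Set (ε → ℕ)} (hP : P.Finite)
    (hex : HasExchange P) (o₁ o₂ : LinearOrder ε) :
    ∑ f ∈ hP.toFinset, (X : ℤ[X]) ^ (@inactive ε o₁ P f).ncard =
      ∑ f ∈ hP.toFinset, X ^ (@inactive ε o₂ P f).ncard := by
  have := Fintype.ofFinite ε
  have hseries := (@mk_ncard_lowerings_mul ε o₁ _ P hP hex).symm.trans
    (@mk_ncard_lowerings_mul ε o₂ _ P hP hex)
  have hcomp : (∑ f ∈ hP.toFinset, (X : ℤ[X]) ^ (@inactive ε o₁ P f).ncard).comp (1 - X) =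
      (∑ f ∈ hP.toFinset, (X : ℤ[X]) ^ (@inactive ε o₂ P f).ncard).comp (1 - X) := by
    refine Polynomial.coe_injective ℤ ?_
    have hX : Polynomial.coeToPowerSeries.ringHom X = (PowerSeries.X : PowerSeries ℤ) :=
      Polynomial.coe_X
    simpa [← Polynomial.coeToPowerSeries.ringHom_apply, hX] using hseries
  have comp_comp (p : ℤ[X]) : (p.comp (1 - X)).comp (1 - X) = p := by simp [Polynomial.comp_assoc]
  rw [← comp_comp (∑ f ∈ _, _), hcomp, comp_comp]

end ExchangeSets

section FiberCounts

variable {A ε : Type*} {N : A → ε → Prop}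

theorem IsTransfer.trans {f g h : ε → ℕ} {e₁ e₂ e₃ : ε} (hfg : IsTransfer f g e₂ e₃)
    (hgh : IsTransfer g h e₁ e₂) (h₁₂ : e₁ ≠ e₂) (h₁₃ : e₁ ≠ e₃) : IsTransfer f h e₁ e₃ := by
  obtain ⟨hf₂, hf₃, hf⟩ := hfg
  obtain ⟨hg₁, hg₂, hg⟩ := hgh
  have h₂₃ : e₂ ≠ e₃ := by
    rintro rfl
    omega
  refine ⟨hf e₁ h₁₂ h₁₃ ▸ hg₁, hf₃ ▸ hg e₃ h₁₃.symm h₂₃.symm, fun e he₁ he₃ => ?_⟩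
  rcases eq_or_ne e e₂ with rfl | he₂
  · omega
  · rw [hg e he₁ he₂, hf e he₂ he₃]

/-- The number of points in each fibre of a map, the hypertree that is read off a map from
vertices to hyperedges. -/
noncomputable def fiberCount (φ : A → ε) (e : ε) : ℕ :=
  {v | φ v = e}.ncard

/-- The fibre counts of the choice functions of a relation. -/
def fiberCounts (N : A → ε → Prop) : Set (ε → ℕ) :=
  {f | ∃ φ : A → ε, (∀ v, N v (φ v)) ∧ fiberCount φ = f}

theorem isTransfer_fiberCount_update [Finite A] [DecidableEq A] (φ : A → ε) {v : A} {e' : ε}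
    (he' : φ v ≠ e') :
    IsTransfer (fiberCount φ) (fiberCount (Function.update φ v e')) (φ v) e' := by
  have h_source : insert v {u | Function.update φ v e' u = φ v} = {u | φ u = φ v} := by
    ext u
    rcases eq_or_ne u v with rfl | huv <;> simp [*]
  have h_target : insert v {u | φ u = e'} = {u | Function.update φ v e' u = e'} := by
    ext u
    rcases eq_or_ne u v with rfl | huv <;> simp [*]
  refine ⟨?_, ?_, fun e he he'' => ?_⟩
  · rw [fiberCount, fiberCount, ← h_source, Set.ncard_insert_of_notMem (by simpa using he'.symm)]
  · rw [fiberCount, fiberCount, ← h_target, Set.ncard_insert_of_notMem (by simpa using he')]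
  · unfold fiberCount
    congr 1
    ext u
    rcases eq_or_ne u v with rfl | huv <;> simp [*, he.symm, he''.symm]

theorem hasExchange_fiberCounts [Finite A] (N : A → ε → Prop) : HasExchange (fiberCounts N) := by
  classical
  rintro _ ⟨φ, hφ, rfl⟩ _ ⟨φ', hφ', rfl⟩ e' he'
  induction hn : {v | φ v ≠ φ' v}.ncard using Nat.strong_induction_on generalizing φ e' with
  | _ n ih =>
  subst hn
  obtain ⟨v, rfl, hv⟩ := Set.exists_mem_notMem_of_ncard_lt_ncard he'
  have ht := isTransfer_fiberCount_update φ hv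
  set φ₁ := Function.update φ v (φ' v) with hφ₁
  have hN₁ (u : A) : N u (φ₁ u) := by
    rcases eq_or_ne u v with rfl | huv <;> simp [*]
  by_cases hlt : fiberCount φ' (φ v) < fiberCount φ (φ v)
  · exact ⟨φ v, hlt, _, ⟨φ₁, hN₁, rfl⟩, ht⟩
  have hcloser : {u | φ₁ u ≠ φ' u} ⊂ {u | φ u ≠ φ' u} := by
    refine ⟨fun u hu => ?_, fun h => h hv (by simp [hφ₁])⟩
    rcases eq_or_ne u v with rfl | huv <;> simp_all
  obtain ⟨e, he, g, hg, htg⟩ :=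
    ih _ (Set.ncard_lt_ncard hcloser) φ₁ hN₁ (φ v) (by have := ht.1; omega) rfl
  have he₁ : e ≠ φ v := by
    rintro rfl
    have := ht.1
    omega
  have he₂ : e ≠ φ' v := by
    rintro rfl
    have := ht.2.1
    omega
  exact ⟨e, ht.2.2 e he₁ he₂ ▸ he, g, hg, ht.trans htg he₁ he₂⟩

theorem mem_inactive_fiberCounts_iff [Finite A] [LinearOrder ε] {r : ε} (hr : ∀ v, N v r)
    (hbot : ∀ e, r ≤ e) {f : ε → ℕ} (hf : f ∈ fiberCounts N) {e : ε} :
    e ∈ inactive (fiberCounts N) f ↔ e ≠ r ∧ f e ≠ 0 := by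
  classical
  constructor
  · rintro ⟨e', he', g, -, ht⟩
    exact ⟨fun h => (hbot e').not_gt (h ▸ he'), by have := ht.1; omega⟩
  · rintro ⟨her, hfe⟩
    obtain ⟨φ, hφ, rfl⟩ := hf
    obtain ⟨v, rfl⟩ := Set.nonempty_of_ncard_ne_zero hfe
    refine ⟨r, (hbot _).lt_of_ne' her, _, ⟨Function.update φ v r, fun u => ?_, rfl⟩,
      isTransfer_fiberCount_update φ her⟩
    rcases eq_or_ne u v with rfl | huv <;> simp [*]

theorem sum_X_pow_ncard_inactive_fiberCounts [Finite A] [Finite ε] [LinearOrder ε] {r : ε}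
    (hr : ∀ v, N v r) {P : Set (ε → ℕ)} (hP : P.Finite) (hPN : P = fiberCounts N) :
    ∑ f ∈ hP.toFinset, (X : ℤ[X]) ^ (inactive P f).ncard =
      ∑ f ∈ hP.toFinset, X ^ {e | e ≠ r ∧ f e ≠ 0}.ncard := by
  subst hPN
  classical
  let key (e : ε) : WithBot ε := if e = r then ⊥ else e
  have hkey : Function.Injective key := fun e e' h => by
    by_cases he : e = r <;> by_cases he' : e' = r <;> simp_all [key]
  have hbot (e : ε) : key r ≤ key e := by simp [key]
  let o : LinearOrder ε := LinearOrder.lift' key hkey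
  rw [sum_X_pow_ncard_inactive_eq hP (hasExchange_fiberCounts N) _ o]
  refine Finset.sum_congr rfl fun f hf => ?_
  congr 2
  ext e
  exact @mem_inactive_fiberCounts_iff A ε N _ o r hr hbot _ (hP.mem_toFinset.1 hf) e

end FiberCounts

theorem existsUnique_adj_dist_eq_dist_add_one {W : Type*} {Γ : SimpleGraph W} (hΓ : Γ.IsTree)
    {u x : W} (hx : x ≠ u) : ∃! y, Γ.Adj x y ∧ Γ.dist u x = Γ.dist u y + 1 := by
  obtain ⟨p, hp, hlen⟩ := hΓ.connected.exists_path_of_dist u x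
  have hnil : ¬ p.Nil := fun h => hx h.eq.symm
  refine ⟨p.penultimate, ⟨(p.adj_penultimate hnil).symm, ?_⟩, fun y ⟨hy, hd⟩ => ?_⟩
  · have h_le : Γ.dist u p.penultimate ≤ p.dropLast.length := SimpleGraph.dist_le _
    have h_len : p.dropLast.length + 1 = p.length := SimpleGraph.Walk.length_dropLast_add_one hnil
    have h_step := hΓ.dist_eq_dist_add_one_of_adj u (p.adj_penultimate hnil)
    omega
  · obtain ⟨q, -, hq⟩ := hΓ.connected.exists_path_of_dist u y
    have hqx : (q.concat hy.symm).IsPath :=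
      SimpleGraph.Walk.isPath_of_length_eq_dist _ (by rw [SimpleGraph.Walk.length_concat, hq, hd])
    rw [(hΓ.existsUnique_path u x).unique hp hqx, SimpleGraph.Walk.penultimate_concat]

theorem exists_parent_function {W : Type*} [Finite W] {Γ : SimpleGraph W} (hΓ : Γ.IsTree) (u : W) :
    ∃ π : W → W, ∀ x ≠ u, Γ.Adj x (π x) ∧
      (Γ.neighborSet x).ncard = {y | y ≠ u ∧ π y = x}.ncard + 1 := by
  have hpar (x : W) (hx : x ≠ u) := existsUnique_adj_dist_eq_dist_add_one hΓ hx
  choose! π hπ hunique using hpar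
  refine ⟨π, fun x hx => ⟨(hπ x hx).1, ?_⟩⟩
  have hneighbors : Γ.neighborSet x = insert (π x) {y | y ≠ u ∧ π y = x} := by
    ext y
    rw [SimpleGraph.mem_neighborSet, Set.mem_insert_iff]
    constructor
    · intro hxy
      rcases hΓ.dist_eq_dist_add_one_of_adj u hxy with h | h
      · exact .inl (hunique x hx y ⟨hxy, h⟩)
      · have hy : y ≠ u := by
          rintro rfl
          simp at h
        exact .inr ⟨hy, (hunique y hy x ⟨hxy.symm, h⟩).symm⟩
    · rintro (rfl | ⟨hy, rfl⟩)
      exacts [(hπ x hx).1, (hπ y hy).1.symm]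
  rw [hneighbors, Set.ncard_insert_of_notMem]
  rintro ⟨hy, hyx⟩
  have h_up := (hπ x hx).2
  have h_down := (hπ _ hy).2
  rw [hyx] at h_down
  omega

namespace MultiHypergraph

variable {α ε : Type*} {H : MultiHypergraph α ε}

theorem bip_adj_inl_inr {v : α} {e : ε} : H.bip.Adj (Sum.inl v) (Sum.inr e) ↔ v ∈ H.edge e := by
  simp [bip]

theorem not_bip_adj_inl_inl {v w : α} : ¬ H.bip.Adj (Sum.inl v) (Sum.inl w) := by
  simp [bip]

theorem not_bip_adj_inr_inr {e e' : ε} : ¬ H.bip.Adj (Sum.inr e) (Sum.inr e') := by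
  simp [bip]

/-- The vertex-hyperedge incidence relation without the vertex `s`, which serves as the root of
the spanning trees. -/
def unrootedIncidence (H : MultiHypergraph α ε) (s : α) (v : {v // v ≠ s}) (e : ε) : Prop :=
  v.1 ∈ H.edge e

theorem hypertrees_subset_fiberCounts [Finite α] [Finite ε] (s : α) :
    H.hypertrees ⊆ fiberCounts (H.unrootedIncidence s) := by
  rintro f ⟨Γ, hle, hΓ, hdeg⟩
  obtain ⟨π, hπ⟩ := exists_parent_function hΓ (Sum.inl s)
  have hedge (v : {v // v ≠ s}) : ∃ e, v.1 ∈ H.edge e ∧ π (Sum.inl v.1) = Sum.inr e := by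
    have hadj := hle (hπ (Sum.inl v.1) (by simpa using v.2)).1
    rcases hv : π (Sum.inl v.1) with w | e
    · exact absurd (hv ▸ hadj) not_bip_adj_inl_inl
    · exact ⟨e, bip_adj_inl_inr.1 (hv ▸ hadj), rfl⟩
  choose φ hφ hπφ using hedge
  refine ⟨φ, hφ, funext fun e => ?_⟩
  have hchildren : {y | y ≠ Sum.inl s ∧ π y = Sum.inr e} =
      (Sum.inl ∘ Subtype.val : {v // v ≠ s} → α ⊕ ε) '' {v | φ v = e} := by
    ext y
    constructor
    · rintro ⟨hy, hye⟩
      rcases y with v | e'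
      · have hv : v ≠ s := by simpa using hy
        exact ⟨⟨v, hv⟩, Sum.inr.inj ((hπφ ⟨v, hv⟩).symm.trans hye), rfl⟩
      · exact absurd (hye ▸ hle (hπ _ hy).1) not_bip_adj_inr_inr
    · rintro ⟨v, rfl, rfl⟩
      exact ⟨by simpa using v.2, hπφ v⟩
  have hcount := (hπ (Sum.inr e) (by simp)).2
  rw [hchildren, Set.ncard_image_of_injective _ (Sum.inl_injective.comp Subtype.val_injective),
    hdeg e] at hcount
  exact (Nat.add_right_cancel hcount).symm

/-- The edges of `assignmentTree`: every hyperedge is joined to `s`, and every other vertex `v` to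
the single hyperedge `φ v`. -/
def assignmentEdge {s : α} (φ : {v // v ≠ s} → ε) : ε ⊕ {v // v ≠ s} → Sym2 (α ⊕ ε) :=
  Sum.elim (fun e => s(Sum.inl s, Sum.inr e)) fun v => s(Sum.inl v.1, Sum.inr (φ v))

/-- The spanning tree of `Bip H` that belongs to a choice of a hyperedge for every vertex other
than `s`. -/
def assignmentTree {s : α} (φ : {v // v ≠ s} → ε) : SimpleGraph (α ⊕ ε) :=
  SimpleGraph.fromEdgeSet (Set.range (assignmentEdge φ))

theorem assignmentEdge_injective {s : α} (φ : {v // v ≠ s} → ε) :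
    Function.Injective (assignmentEdge φ) := by
  rintro (e | v) (e' | v') h
  · simpa [assignmentEdge] using h
  · exact (v'.2 (by simp_all [assignmentEdge])).elim
  · exact (v.2 (by simp_all [assignmentEdge])).elim
  · exact congrArg _ (Subtype.ext (by simp_all [assignmentEdge]))

theorem assignmentTree_adj_inr {s : α} {φ : {v // v ≠ s} → ε} {x : α ⊕ ε} {e : ε} :
    (assignmentTree φ).Adj x (Sum.inr e) ↔ x = Sum.inl s ∨ ∃ v, φ v = e ∧ x = Sum.inl v.1 := by
  rcases x with v | e' <;> simp [assignmentTree, assignmentEdge, eq_comm]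

theorem connected_assignmentTree {s : α} (φ : {v // v ≠ s} → ε) :
    (assignmentTree φ).Connected := by
  have hroot (e : ε) : (assignmentTree φ).Adj (Sum.inl s) (Sum.inr e) :=
    assignmentTree_adj_inr.2 (.inl rfl)
  have hleaf (v : {v // v ≠ s}) : (assignmentTree φ).Adj (Sum.inl v.1) (Sum.inr (φ v)) :=
    assignmentTree_adj_inr.2 (.inr ⟨v, rfl, rfl⟩)
  rw [SimpleGraph.connected_iff_exists_forall_reachable]
  refine ⟨Sum.inl s, ?_⟩
  rintro (v | e)
  · by_cases hv : v = s
    · rw [hv]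
    · exact (hroot (φ ⟨v, hv⟩)).reachable.trans (hleaf ⟨v, hv⟩).symm.reachable
  · exact (hroot e).reachable

theorem isTree_assignmentTree [Finite α] [Finite ε] {s : α} (φ : {v // v ≠ s} → ε) :
    (assignmentTree φ).IsTree := by
  classical
  have hedges : (assignmentTree φ).edgeSet = Set.range (assignmentEdge φ) := by
    rw [assignmentTree, SimpleGraph.edgeSet_fromEdgeSet, sdiff_eq_left, Set.disjoint_left]
    rintro _ ⟨e | v, rfl⟩ <;> simp [assignmentEdge]
  have hcard : Nat.card {v // v ≠ s} + 1 = Nat.card α := by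
    rw [← Finite.card_option, Nat.card_congr (Equiv.optionSubtypeNe s)]
  refine SimpleGraph.isTree_iff_connected_and_card.2 ⟨connected_assignmentTree φ, ?_⟩
  rw [hedges, ← Nat.card_congr (Equiv.ofInjective _ (assignmentEdge_injective φ)), Nat.card_sum,
    Nat.card_sum, ← hcard]
  omega

theorem hypertrees_eq_fiberCounts [Finite α] [Finite ε] {s : α} (hs : ∀ e, s ∈ H.edge e) :
    H.hypertrees = fiberCounts (H.unrootedIncidence s) := by
  refine (hypertrees_subset_fiberCounts s).antisymm ?_
  rintro _ ⟨φ, hφ, rfl⟩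
  refine ⟨assignmentTree φ, ?_, isTree_assignmentTree φ, fun e => ?_⟩
  · refine SimpleGraph.fromEdgeSet_mono ?_
    rintro _ ⟨e | v, rfl⟩
    exacts [⟨s, e, hs e, rfl⟩, ⟨v, φ v, hφ v, rfl⟩]
  · have hneighbors : (assignmentTree φ).neighborSet (Sum.inr e) =
        insert (Sum.inl s) ((Sum.inl ∘ Subtype.val) '' {v | φ v = e}) := by
      ext x
      rw [SimpleGraph.mem_neighborSet, SimpleGraph.adj_comm, assignmentTree_adj_inr]
      simp [eq_comm]
    rw [hneighbors, Set.ncard_insert_of_notMem (by simp),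
      Set.ncard_image_of_injective _ (Sum.inl_injective.comp Subtype.val_injective)]
    rfl

theorem interiorPolynomial_eq_sum_support [Finite α] [Finite ε] [LinearOrder ε] {s : α} {r : ε}
    (hs : ∀ e, s ∈ H.edge e) (hr : ∀ v, v ∈ H.edge r) :
    H.interiorPolynomial =
      ∑ f ∈ H.hypertrees_finite.toFinset, X ^ {e | e ≠ r ∧ f e ≠ 0}.ncard := by
  have hinterior : H.interiorPolynomial =
    ∑ f ∈ H.hypertrees_finite.toFinset, X ^ (inactive H.hypertrees f).ncard := rfl
  rw [hinterior, sum_X_pow_ncard_inactive_fiberCounts (N := H.unrootedIncidence s)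
    (fun v => hr v) _ (hypertrees_eq_fiberCounts hs)]

end MultiHypergraph

section Potentials

open Finset
open scoped Classical

variable {A B : Type*} [Fintype B] {N : A → B → Prop} {w : A → Option B → ℝ} {S : Finset A}

/-- The choices of the agent `v`: the items that it may take, or `none`. -/
noncomputable def options (N : A → B → Prop) (v : A) : Finset (Option B) :=
  insertNone {b | N v b}

/-- The gain of the agent `v` from the option `o` when `y b` is paid for taking the item `b`, and
the cost of an option is `w v o`. -/
def gain (w : A → Option B → ℝ) (y : B → ℝ) (v : A) (o : Option B) : ℝ :=
  o.elim 0 y - w v o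

theorem options_nonempty (N : A → B → Prop) (v : A) : (options N v).Nonempty :=
  ⟨none, by simp [options]⟩

/-- The largest gain that the agent `v` can obtain. -/
noncomputable def bestGain (N : A → B → Prop) (w : A → Option B → ℝ) (y : B → ℝ) (v : A) : ℝ :=
  (options N v).sup' (options_nonempty N v) (gain w y v)

/-- The options with which the agent `v` obtains the largest gain. -/
noncomputable def bestOptions (N : A → B → Prop) (w : A → Option B → ℝ) (y : B → ℝ) (v : A) :
    Finset (Option B) :=
  {o ∈ options N v | gain w y v o = bestGain N w y v}

/-- The prices `y` are balanced for the demand `f` on the agents in `S`: every nonempty set of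
items is preferred strictly to all other options by fewer agents than it demands, while as many
agents as it demands have one of its items among their best options. -/
def IsBalanced (N : A → B → Prop) (w : A → Option B → ℝ) (S : Finset A) (f : B → ℕ)
    (y : B → ℝ) : Prop :=
  ∀ K : Finset B, K.Nonempty →
    #{v ∈ S | bestOptions N w y v ⊆ K.map .some} < ∑ b ∈ K, f b ∧
      ∑ b ∈ K, f b ≤ #{v ∈ S | ∃ b ∈ K, some b ∈ bestOptions N w y v}

/-- There are disjoint sets of agents, of the sizes prescribed by `f`, such that the agents in the
set of `b` may all take `b`. -/
def IsPackingVector (N : A → B → Prop) (f : B → ℕ) : Prop :=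
  ∃ C : B → Finset A, Pairwise (Function.onFun Disjoint C) ∧ (∀ b, ∀ v ∈ C b, N v b) ∧
    ∀ b, #(C b) = f b

variable {y y' : B → ℝ} {v : A}

theorem gain_le_bestGain {o : Option B} (ho : o ∈ options N v) :
    gain w y v o ≤ bestGain N w y v :=
  le_sup' _ ho

theorem gain_le_gain_of_mem_bestOptions {o o' : Option B} (ho : o ∈ bestOptions N w y v)
    (ho' : o' ∈ options N v) : gain w y v o' ≤ gain w y v o :=
  (mem_filter.1 ho).2 ▸ gain_le_bestGain ho'

theorem bestOptions_nonempty (N : A → B → Prop) (w : A → Option B → ℝ) (y : B → ℝ) (v : A) :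
    (bestOptions N w y v).Nonempty := by
  obtain ⟨o, ho, hmax⟩ := exists_mem_eq_sup' (options_nonempty N v) (gain w y v)
  exact ⟨o, mem_filter.2 ⟨ho, hmax.symm⟩⟩

theorem relation_of_some_mem_bestOptions {b : B} (hb : some b ∈ bestOptions N w y v) : N v b := by
  simpa [options] using (mem_filter.1 hb).1

/- If `K` is the set of items where `y - y'` attains a positive maximum, then an agent that finds an
item of `K` best at the prices `y'` finds only items of `K` best at the prices `y`. -/
theorem IsBalanced.le {f : B → ℕ} (hy : IsBalanced N w S f y) (hy' : IsBalanced N w S f y') :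
    y ≤ y' := by
  by_contra hle
  obtain ⟨b₀, hb₀⟩ : ∃ b, y' b < y b := by simpa [Pi.le_def] using hle
  obtain ⟨m, -, hm⟩ := exists_max_image univ (fun b => y b - y' b) ⟨b₀, mem_univ _⟩
  let K : Finset B := {b | y b - y' b = y m - y' m}
  have hK : K.Nonempty := ⟨m, by simp [K]⟩
  refine ((hy K hK).1.trans_le ((hy' K hK).2.trans (card_le_card ?_))).false
  intro v hv
  obtain ⟨hvS, b, hbK, hb⟩ := mem_filter.1 hv
  refine mem_filter.2 ⟨hvS, fun o ho => ?_⟩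
  have hgain := gain_le_gain_of_mem_bestOptions ho (mem_filter.1 hb).1
  have hgain' := gain_le_gain_of_mem_bestOptions hb (mem_filter.1 ho).1
  have hbm : y b - y' b = y m - y' m := by simpa [K] using hbK
  rcases o with _ | b'
  · have := hm b₀ (mem_univ _)
    simp only [gain, Option.elim_none, Option.elim_some] at hgain hgain'
    linarith
  · have := hm b' (mem_univ _)
    simp only [gain, Option.elim_some] at hgain hgain'
    exact mem_map.2 ⟨b', by simp only [K, mem_filter, mem_univ, true_and]; linarith, rfl⟩

theorem IsBalanced.unique {f : B → ℕ} (hy : IsBalanced N w S f y) (hy' : IsBalanced N w S f y') :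
    y = y' :=
  (hy.le hy').antisymm (hy'.le hy)

/-- The function of the prices whose minimisers are balanced, if the demands `c` are those of `f`
lowered by a small amount. -/
noncomputable def excessGain (N : A → B → Prop) (w : A → Option B → ℝ) (S : Finset A) (c : B → ℝ)
    (y : B → ℝ) : ℝ :=
  ∑ v ∈ S, bestGain N w y v - ∑ b, c b * y b

theorem eventually_bestGain_add_smul_le (y d : B → ℝ) {m : ℝ}
    (hm : ∀ o ∈ bestOptions N w y v, o.elim 0 d ≤ m) :
    ∀ᶠ t in nhdsWithin 0 (Set.Ioi (0 : ℝ)),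
      bestGain N w (y + t • d) v ≤ bestGain N w y v + t * m := by
  have hoption (o : Option B) (ho : o ∈ options N v) : ∀ᶠ t in nhdsWithin 0 (Set.Ioi (0 : ℝ)),
      gain w y v o + t * o.elim 0 d ≤ bestGain N w y v + t * m := by
    by_cases hbest : o ∈ bestOptions N w y v
    · filter_upwards [self_mem_nhdsWithin] with t ht
      exact add_le_add (gain_le_bestGain ho) (mul_le_mul_of_nonneg_left (hm o hbest) ht.le)
    · have hlt : gain w y v o + 0 * o.elim 0 d < bestGain N w y v + 0 * m := by
        simpa using (gain_le_bestGain ho).lt_of_ne fun h => hbest (mem_filter.2 ⟨ho, h⟩)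
      refine nhdsWithin_le_nhds ((ContinuousAt.eventually_lt ?_ ?_ hlt).mono fun t => le_of_lt)
      all_goals fun_prop
  filter_upwards [(Filter.eventually_all_finset _).2 hoption] with t ht
  refine sup'_le _ _ fun o ho => le_trans (le_of_eq ?_) (ht o ho)
  cases o <;> simp only [gain, Option.elim, Pi.add_apply, Pi.smul_apply, smul_eq_mul] <;> ring

theorem sum_mul_le_sum_of_isMin {c d : B → ℝ} {m : A → ℝ}
    (hmin : ∀ y', excessGain N w S c y ≤ excessGain N w S c y')
    (hm : ∀ v ∈ S, ∀ o ∈ bestOptions N w y v, o.elim 0 d ≤ m v) :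
    ∑ b, c b * d b ≤ ∑ v ∈ S, m v := by
  have hev := (Filter.eventually_all_finset S).2 fun v hv =>
    eventually_bestGain_add_smul_le y d (hm v hv)
  obtain ⟨t, hgain, ht⟩ := (hev.and self_mem_nhdsWithin).exists
  have hsum := sum_le_sum hgain
  have hstep := hmin (y + t • d)
  simp only [excessGain, Pi.add_apply, Pi.smul_apply, smul_eq_mul, mul_add, sum_add_distrib,
    mul_left_comm _ t, ← mul_sum] at hsum hstep
  exact le_of_mul_le_mul_left (by linarith) ht

theorem isBalanced_of_isMin {f : B → ℕ} {δ : ℝ} (hδ : 0 < δ) (hδB : Fintype.card B * δ < 1)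
    (hmin : ∀ y', excessGain N w S (fun b => f b - δ) y ≤ excessGain N w S (fun b => f b - δ) y') :
    IsBalanced N w S f y := by
  intro K hK
  have hK_pos : 0 < #K * δ := mul_pos (by exact_mod_cast hK.card_pos) hδ
  have hK_lt : #K * δ < 1 :=
    (mul_le_mul_of_nonneg_right (by exact_mod_cast card_le_univ K) hδ.le).trans_lt hδB
  have h_items (t : ℝ) : ∑ b, (f b - δ) * (if b ∈ K then t else 0) =
      t * ((∑ b ∈ K, f b : ℕ) - #K * δ) := by
    simp [← mul_sum, mul_comm _ t, mul_sub, mul_left_comm _ t]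
  have h_agents (p : A → Prop) [DecidablePred p] (t : ℝ) :
      (∑ v ∈ S, if p v then t else 0) = t * #{v ∈ S | p v} := by
    simp [sum_ite, mul_comm]
  constructor
  · have hstep := sum_mul_le_sum_of_isMin (d := fun b => if b ∈ K then -1 else 0)
      (m := fun v => if bestOptions N w y v ⊆ K.map .some then -1 else 0) hmin fun v _ o ho => by
        split_ifs with hv
        · obtain ⟨b, hb, rfl⟩ := mem_map.1 (hv ho)
          simp [hb]
        · cases o <;> simp [ite_nonpos]
    rw [h_items, h_agents] at hstep
    exact_mod_cast show (#{v ∈ S | bestOptions N w y v ⊆ K.map .some} : ℝ) < (∑ b ∈ K, f b : ℕ) by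
      linarith
  · have hstep := sum_mul_le_sum_of_isMin (d := fun b => if b ∈ K then 1 else 0)
      (m := fun v => if ∃ b ∈ K, some b ∈ bestOptions N w y v then 1 else 0) hmin
      fun v _ o ho => by
        rcases o with _ | b
        · simp only [Option.elim]
          positivity
        · by_cases hb : b ∈ K
          · simp [hb, show ∃ b ∈ K, some b ∈ bestOptions N w y v from ⟨b, hb, ho⟩]
          · simp only [Option.elim, hb, if_false]
            positivity
    rw [h_items, h_agents] at hstep
    refine Nat.lt_succ_iff.1 ?_
    exact_mod_cast show ((∑ b ∈ K, f b : ℕ) : ℝ) <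
      #{v ∈ S | ∃ b ∈ K, some b ∈ bestOptions N w y v} + 1 by linarith

theorem continuous_excessGain (N : A → B → Prop) (w : A → Option B → ℝ) (S : Finset A)
    (c : B → ℝ) : Continuous (excessGain N w S c) := by
  have hbest (v : A) : Continuous fun y => bestGain N w y v :=
    Continuous.finset_sup'_apply _ fun o _ => by
      cases o <;> simp only [gain, Option.elim] <;> fun_prop
  unfold excessGain
  fun_prop

theorem neg_le_bestGain {C₀ : ℝ} (hw : |w v none| ≤ C₀) (y : B → ℝ) :
    -C₀ ≤ bestGain N w y v := by
  have h_none : gain w y v none ≤ bestGain N w y v := gain_le_bestGain (by simp [options])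
  simp only [gain, Option.elim] at h_none
  linarith [(abs_le.1 hw).2]

theorem max_le_bestGain_add {C₀ : ℝ} (hw : ∀ o, |w v o| ≤ C₀) {b : B} (hb : N v b) (y : B → ℝ) :
    max (y b) 0 ≤ bestGain N w y v + C₀ := by
  have h_some : gain w y v (some b) ≤ bestGain N w y v := gain_le_bestGain (by simp [options, hb])
  have h_none := neg_le_bestGain (N := N) (hw none) y
  simp only [gain, Option.elim] at h_some
  exact max_le (by linarith [(abs_le.1 (hw (some b))).2]) (by linarith)

theorem norm_sub_le_excessGain {f : B → ℕ} {δ C₀ : ℝ} (hf : ∀ b, 0 < f b) (hδ : 0 ≤ δ)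
    (hδ' : 2 * δ ≤ 1) (hpack : IsPackingVector (fun v b => v ∈ S ∧ N v b) f)
    (hw : ∀ v ∈ S, ∀ o, |w v o| ≤ C₀) (y : B → ℝ) :
    δ * ‖y‖ - #S * C₀ ≤ excessGain N w S (fun b => f b - δ) y := by
  obtain ⟨C, hdisj, hC, hcard⟩ := hpack
  have h_agents : ∑ b, f b * max (y b) 0 ≤ ∑ v ∈ S, (bestGain N w y v + C₀) := by
    calc ∑ b, f b * max (y b) 0
        = ∑ b, ∑ _ ∈ C b, max (y b) 0 := by simp [hcard]
      _ ≤ ∑ b, ∑ v ∈ C b, (bestGain N w y v + C₀) := sum_le_sum fun b _ => sum_le_sum fun _ hv =>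
          max_le_bestGain_add (hw _ (hC b _ hv).1) (hC b _ hv).2 y
      _ = ∑ v ∈ univ.biUnion C, (bestGain N w y v + C₀) :=
          (sum_biUnion fun b _ b' _ h => hdisj h).symm
      _ ≤ _ := sum_le_sum_of_subset_of_nonneg
          (biUnion_subset.2 fun b _ _ hv => (hC b _ hv).1) fun _ hv _ => by
            linarith [neg_le_bestGain (N := N) (hw _ hv none) y]
  have h_items (b : B) : δ * |y b| ≤ f b * max (y b) 0 - (f b - δ) * y b := by
    have hfb : (1 : ℝ) ≤ f b := by exact_mod_cast hf b
    rcases le_total 0 (y b) with hy | hy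
    · rw [abs_of_nonneg hy, max_eq_left hy]
      linarith
    · rw [abs_of_nonpos hy, max_eq_right hy]
      nlinarith
  have h_norm : ‖y‖ ≤ ∑ b, |y b| := (pi_norm_le_iff_of_nonneg (by positivity)).2 fun b =>
    single_le_sum (f := fun b => |y b|) (fun _ _ => abs_nonneg _) (mem_univ b)
  have h_sum := sum_le_sum fun b (_ : b ∈ univ) => h_items b
  simp only [sum_sub_distrib, ← mul_sum, sum_add_distrib, sum_const, nsmul_eq_mul] at h_sum h_agents
  have := mul_le_mul_of_nonneg_left h_norm hδ
  unfold excessGain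
  linarith

theorem IsPackingVector.exists_isBalanced {f : B → ℕ} (hf : ∀ b, 0 < f b)
    (hpack : IsPackingVector (fun v b => v ∈ S ∧ N v b) f) (w : A → Option B → ℝ) :
    ∃ y, IsBalanced N w S f y := by
  let δ : ℝ := (Fintype.card B + 2 : ℝ)⁻¹
  have hδ : 0 < δ := by positivity
  have hδ_mul : (Fintype.card B + 2) * δ = 1 := mul_inv_cancel₀ (by positivity)
  have hδB : 0 ≤ Fintype.card B * δ := by positivity
  obtain ⟨C₀, hC₀⟩ : ∃ C₀, ∀ v ∈ S, ∀ o, |w v o| ≤ C₀ := by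
    obtain ⟨C₀, hC₀⟩ := ((S ×ˢ univ).image fun p => |w p.1 p.2|).exists_le
    exact ⟨C₀, fun v hv o => hC₀ _ (mem_image_of_mem _ (mk_mem_product hv (mem_univ o)))⟩
  have hbound := norm_sub_le_excessGain hf hδ.le (by linarith) hpack hC₀
  have hcoercive : Filter.Tendsto (excessGain N w S fun b => f b - δ)
      (Filter.cocompact (B → ℝ)) Filter.atTop := by
    refine Filter.tendsto_atTop_mono hbound (Filter.tendsto_atTop_add_const_right _ _ ?_)
    exact tendsto_norm_cocompact_atTop.const_mul_atTop hδ
  obtain ⟨y, hy⟩ := (continuous_excessGain N w S _).exists_forall_le hcoercive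
  exact ⟨y, isBalanced_of_isMin hδ (by linarith) hy⟩

end Potentials

section PackingVectors

open Finset
open scoped Classical

variable {A B : Type*} {N : A → B → Prop} {S : Finset A} {f : B → ℕ}

theorem isPackingVector_of_sum_le
    (h : ∀ K : Finset B, K.Nonempty → ∑ b ∈ K, f b ≤ #{v ∈ S | ∃ b ∈ K, N v b}) :
    IsPackingVector (fun v b => v ∈ S ∧ N v b) f := by
  let t (i : Σ b, Fin (f b)) : Finset A := {v ∈ S | N v i.1}
  have h_hall (s : Finset (Σ b, Fin (f b))) : #s ≤ #(s.biUnion t) := by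
    rcases s.eq_empty_or_nonempty with rfl | hs
    · simp
    calc #s ≤ #((s.image Sigma.fst).sigma fun _ => univ) :=
          card_le_card fun i hi => mem_sigma.2 ⟨mem_image_of_mem _ hi, mem_univ _⟩
      _ = ∑ b ∈ s.image Sigma.fst, f b := by simp
      _ ≤ _ := h _ (hs.image _)
      _ ≤ #(s.biUnion t) := card_le_card fun v hv => by
          simp only [mem_filter, mem_image, exists_exists_and_eq_and] at hv
          simpa [t, hv.1] using hv.2
  obtain ⟨g, hg, hgt⟩ := (all_card_le_biUnion_card_iff_exists_injective t).1 h_hall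
  refine ⟨fun b => univ.image fun i => g ⟨b, i⟩, fun b b' hne => ?_, fun b v hv => ?_, fun b => ?_⟩
  · refine disjoint_left.2 fun v hv hv' => hne ?_
    obtain ⟨i, -, hi⟩ := mem_image.1 hv
    obtain ⟨i', -, hi'⟩ := mem_image.1 hv'
    exact congrArg Sigma.fst (hg (hi.trans hi'.symm))
  · obtain ⟨i, -, rfl⟩ := mem_image.1 hv
    exact mem_filter.1 (hgt ⟨b, i⟩)
  · exact (card_image_of_injective univ (hg.comp sigma_mk_injective)).trans (card_fin _)

theorem isPackingVector_one_iff_exists_equiv [Fintype B] (hS : #S = Fintype.card B) :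
    IsPackingVector (fun v b => v ∈ S ∧ N v b) 1 ↔ ∃ σ : B ≃ S, ∀ b, N (σ b) b := by
  constructor
  · rintro ⟨C, h_disjoint, hC, hcard⟩
    choose σ hσ using fun b => card_eq_one.1 (hcard b)
    have h_mem (b : B) : σ b ∈ S ∧ N (σ b) b := hC b _ (hσ b ▸ mem_singleton_self _)
    have h_inj : Function.Injective fun b => (⟨σ b, (h_mem b).1⟩ : S) := by
      intro b b' h
      by_contra hne
      have := h_disjoint hne
      simp_all [Function.onFun]
    exact ⟨.ofBijective _ ((Fintype.bijective_iff_injective_and_card _).2 ⟨h_inj, by simp [hS]⟩),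
      fun b => (h_mem b).2⟩
  · rintro ⟨σ, hσ⟩
    refine ⟨fun b => {(σ b).1}, fun b b' hne => ?_, by simpa using hσ, by simp⟩
    simpa [Function.onFun, Subtype.ext_iff] using σ.injective.ne hne

theorem IsBalanced.isPackingVector [Fintype B] {w : A → Option B → ℝ} {y : B → ℝ}
    (hy : IsBalanced N w S f y) : IsPackingVector (fun v b => v ∈ S ∧ N v b) f := by
  refine isPackingVector_of_sum_le fun K hK => (hy K hK).2.trans (card_le_card ?_)
  exact monotone_filter_right _ fun v _ ⟨b, hbK, hb⟩ =>
    ⟨b, hbK, relation_of_some_mem_bestOptions hb⟩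

end PackingVectors

section GenericCosts

open Finset
open scoped Classical

variable {A B : Type*} [Fintype A] [Fintype B] {N : A → B → Prop} {w : A → Option B → ℝ}
  {S : Finset A} {y : B → ℝ} {f : B → ℕ}

theorem linearIndependent_sub {ι κ R M : Type*} [Ring R] [AddCommGroup M] [Module R M]
    [Finite ι] {w : ι × κ → M} (hw : LinearIndependent R w) {o o' : ι → κ}
    (ho : ∀ i, o i ≠ o' i) : LinearIndependent R fun i => w (i, o i) - w (i, o' i) := by
  have hinj : Function.Injective
      (Sum.elim (fun i => (i, o i)) fun i => (i, o' i) : ι ⊕ ι → ι × κ) := by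
    rintro (i | i) (j | j) h <;> obtain ⟨rfl, h⟩ := Prod.mk.inj h
    · rfl
    · exact absurd h (ho i)
    · exact absurd h.symm (ho i)
    · rfl
  have := Fintype.ofFinite ι
  have hpair := Fintype.linearIndependent_iff.1 (hw.comp _ hinj)
  refine Fintype.linearIndependent_iff.2 fun c hc i => hpair (Sum.elim c (-c)) ?_ (.inl i)
  simpa [smul_sub, sub_eq_add_neg, sum_add_distrib] using hc

theorem exists_linearIndependent_real (ι : Type*) [Finite ι] :
    ∃ w : ι → ℝ, LinearIndependent ℚ w := by
  have hrank : (Nat.card ι : Cardinal) ≤ Module.rank ℚ ℝ :=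
    Real.rank_rat_real ▸ (Cardinal.natCast_lt_aleph0.trans Cardinal.aleph0_lt_continuum).le
  obtain ⟨w, hw⟩ := exists_linearIndependent_of_le_rank hrank
  exact ⟨w ∘ Finite.equivFin ι, hw.comp _ (Finite.equivFin ι).injective⟩

/- The indifference of an agent between two options of `K` expresses the difference of their costs
by the differences of at most `#K - 1` prices, but for distinct agents these differences of costs
are independent. -/
theorem card_nontrivial_bestOptions_subset_lt
    (hw : LinearIndependent ℚ fun p : A × Option B => w p.1 p.2) (y : B → ℝ)
    {K : Finset (Option B)} (hK : K.Nonempty) :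
    #{v | (bestOptions N w y v).Nontrivial ∧ bestOptions N w y v ⊆ K} < #K := by
  set T : Finset A := {v | (bestOptions N w y v).Nontrivial ∧ bestOptions N w y v ⊆ K}
  obtain ⟨k, hk⟩ := hK
  have hT (v : T) : ∃ o o', o ∈ bestOptions N w y v ∧ o' ∈ bestOptions N w y v ∧ o ≠ o' := by
    obtain ⟨o, ho, o', ho', hne⟩ := (mem_filter.1 v.2).2.1
    exact ⟨o, o', ho, ho', hne⟩
  choose o o' ho ho' hne using hT
  let price (o : Option B) : ℝ := o.elim 0 y
  let D : Finset ℝ := (K.erase k).image fun o => price o - price k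
  have h_mem_span (v : T) (o : Option B) (ho : o ∈ bestOptions N w y v) :
      price o - price k ∈ Submodule.span ℚ (D : Set ℝ) := by
    rcases eq_or_ne o k with rfl | hok
    · simp
    · exact Submodule.subset_span
        (mem_image_of_mem _ (mem_erase.2 ⟨hok, (mem_filter.1 v.2).2.2 ho⟩))
  have h_span : Set.range (fun v : T => w v (o v) - w v (o' v)) ≤
      Submodule.span ℚ (D : Set ℝ) := by
    rintro _ ⟨v, rfl⟩
    have h_eq : w v (o v) - w v (o' v) =
        (price (o v) - price k) - (price (o' v) - price k) := by
      have := (mem_filter.1 (ho v)).2.trans (mem_filter.1 (ho' v)).2.symm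
      unfold gain at this
      linarith
    dsimp only
    exact h_eq ▸ sub_mem (h_mem_span v _ (ho v)) (h_mem_span v _ (ho' v))
  have h_restrict : LinearIndependent ℚ fun p : T × Option B => w p.1 p.2 :=
    hw.comp (fun p : T × Option B => (p.1.1, p.2))
      (Subtype.val_injective.prodMap Function.injective_id)
  have h_card := linearIndependent_le_span_aux' _ (linearIndependent_sub h_restrict hne) _ h_span
  calc #T ≤ #D := by simpa using h_card
    _ ≤ #(K.erase k) := card_image_le
    _ < #K := card_erase_lt_of_mem hk

/-- The agents with more than one best option. -/
noncomputable def contested (N : A → B → Prop) (w : A → Option B → ℝ) (y : B → ℝ) : Finset A :=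
  {v | (bestOptions N w y v).Nontrivial}

/-- The number of agents with `b` as their only best option. -/
noncomputable def settled (N : A → B → Prop) (w : A → Option B → ℝ) (y : B → ℝ) (b : B) : ℕ :=
  #{v | bestOptions N w y v = {some b}}

theorem card_filter_bestOptions (y : B → ℝ) {p : Finset (Option B) → Prop} [DecidablePred p]
    {K : Finset B} (hp : ∀ o, p {o} ↔ ∃ b ∈ K, o = some b) :
    #{v | p (bestOptions N w y v)} =
      ∑ b ∈ K, settled N w y b + #{v ∈ contested N w y | p (bestOptions N w y v)} := by
  have h_settled : ({v | p (bestOptions N w y v) ∧ ¬(bestOptions N w y v).Nontrivial} : Finset A) =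
      K.biUnion fun b => {v | bestOptions N w y v = {some b}} := by
    ext v
    simp only [mem_filter, mem_univ, true_and, mem_biUnion]
    constructor
    · rintro ⟨hv, hnt⟩
      obtain ⟨o, ho⟩ :=
        (bestOptions_nonempty N w y v).exists_eq_singleton_or_nontrivial.resolve_right hnt
      obtain ⟨b, hb, rfl⟩ := (hp o).1 (ho ▸ hv)
      exact ⟨b, hb, ho⟩
    · rintro ⟨b, hb, hv⟩
      exact ⟨hv ▸ (hp _).2 ⟨b, hb, rfl⟩, by simp [hv]⟩
  have h_disjoint : (K : Set B).PairwiseDisjoint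
      fun b => ({v | bestOptions N w y v = {some b}} : Finset A) := by
    intro b _ b' _ hne
    refine disjoint_filter.2 fun v _ hv hv' => hne ?_
    simpa using hv.symm.trans hv'
  rw [← card_filter_add_card_filter_not (fun v => (bestOptions N w y v).Nontrivial), filter_filter,
    filter_filter, h_settled, card_biUnion h_disjoint, add_comm, contested, filter_filter]
  simp only [settled, and_comm]

theorem isBalanced_settled_add_one_iff :
    IsBalanced N w univ (fun b => settled N w y b + 1) y ↔
      IsBalanced N w (contested N w y) 1 y := by
  refine forall₂_congr fun K _ => ?_
  rw [card_filter_bestOptions y (p := (· ⊆ K.map .some)) (K := K) (by simp [eq_comm]),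
    card_filter_bestOptions y (p := fun O => ∃ b ∈ K, some b ∈ O) (K := K) (by simp [eq_comm]),
    sum_add_distrib]
  simp only [add_lt_add_iff_left, add_le_add_iff_left, Pi.one_apply]

theorem card_contested_le (hw : LinearIndependent ℚ fun p : A × Option B => w p.1 p.2) :
    #(contested N w y) ≤ Fintype.card B := by
  have h := card_nontrivial_bestOptions_subset_lt (N := N) hw y (univ_nonempty (α := Option B))
  simpa [contested, Nat.lt_succ_iff] using h

theorem IsBalanced.eq_settled_add_one (hy : IsBalanced N w univ f y)
    (hw : LinearIndependent ℚ fun p : A × Option B => w p.1 p.2) :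
    f = fun b => settled N w y b + 1 := by
  have h_ge (b : B) : settled N w y b + 1 ≤ f b := by
    have h := (hy {b} (singleton_nonempty b)).1
    rw [sum_singleton] at h
    refine (Nat.succ_le_succ (card_le_card ?_)).trans h
    exact monotone_filter_right _ fun v _ hv => by simp [hv]
  have h_le (K : Finset B) (hK : K.Nonempty) : ∑ b ∈ K, f b ≤ ∑ b ∈ K, settled N w y b +
      Fintype.card B := by
    have h := (hy K hK).2
    rw [card_filter_bestOptions y (p := fun O => ∃ b ∈ K, some b ∈ O) (K := K)
      (by simp [eq_comm])] at h
    exact h.trans (add_le_add_right ((card_filter_le _ _).trans (card_contested_le hw)) _)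
  funext b
  have h_sum : ∑ b, f b ≤ ∑ b, (settled N w y b + 1) := by
    simpa [sum_add_distrib] using h_le univ ⟨b, mem_univ b⟩
  have h_eq := (sum_le_sum fun b _ => h_ge b).antisymm h_sum
  exact ((sum_eq_sum_iff_of_le fun b _ => h_ge b).1 h_eq b (mem_univ b)).symm

theorem IsBalanced.card_contested (hy : IsBalanced N w (contested N w y) 1 y)
    (hw : LinearIndependent ℚ fun p : A × Option B => w p.1 p.2) :
    #(contested N w y) = Fintype.card B := by
  refine (card_contested_le hw).antisymm ?_
  rcases isEmpty_or_nonempty B with _ | _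
  · simp
  · simpa using (hy univ univ_nonempty).2.trans (card_filter_le _ _)

theorem IsBalanced.eq_contested (hy : IsBalanced N w S 1 y) (hS : #S = Fintype.card B)
    (hw : LinearIndependent ℚ fun p : A × Option B => w p.1 p.2) : S = contested N w y := by
  refine eq_of_subset_of_card_le (fun v hv => ?_) (hS ▸ card_contested_le hw)
  have : Nonempty B := Fintype.card_pos_iff.1 (hS ▸ card_pos.2 ⟨v, hv⟩)
  have h_card := (hy univ univ_nonempty).2
  rw [show ∑ b, (1 : B → ℕ) b = #S by simp [hS]] at h_card
  have h_all := eq_of_subset_of_card_le (filter_subset _ _) h_card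
  obtain ⟨b, -, hb⟩ := (mem_filter.1 (h_all.symm ▸ hv)).2
  refine mem_filter.2 ⟨mem_univ v, ?_⟩
  by_contra hnt
  have h_single : bestOptions N w y v ⊆ ({b} : Finset B).map .some := by
    obtain ⟨o, ho⟩ :=
      (bestOptions_nonempty N w y v).exists_eq_singleton_or_nontrivial.resolve_right hnt
    obtain rfl : some b = o := by simpa [ho] using hb
    simp [ho]
  have h_lt := (hy {b} (singleton_nonempty b)).1
  rw [sum_singleton, Pi.one_apply, Nat.lt_one_iff, card_eq_zero] at h_lt
  exact notMem_empty v (h_lt ▸ mem_filter.2 ⟨hv, h_single⟩)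

/- Both sides are images of the prices that are balanced for the demand `1` on the agents that they
leave contested: such prices settle a packing vector lowered by `1`, and the contested agents are
matched. -/
theorem ncard_isPackingVector_pos_eq_ncard_exists_equiv {A B : Type*} [Finite A] [Finite B]
    (N : A → B → Prop) :
    {f | (∀ b, 0 < f b) ∧ IsPackingVector N f}.ncard =
      {S : Finset A | ∃ σ : B ≃ S, ∀ b, N (σ b) b}.ncard := by
  have := Fintype.ofFinite A
  have := Fintype.ofFinite B
  obtain ⟨c, hw⟩ := exists_linearIndependent_real (A × Option B)
  let w (v : A) (o : Option B) : ℝ := c (v, o)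
  let Y : Set (B → ℝ) := {y | IsBalanced N w (contested N w y) 1 y}
  have h_packing : Set.BijOn (fun y b => settled N w y b + 1) Y
      {f | (∀ b, 0 < f b) ∧ IsPackingVector N f} := by
    refine ⟨fun y hy => ⟨fun b => Nat.succ_pos _, ?_⟩, fun y hy y' hy' h => ?_, fun f hf => ?_⟩
    · simpa using (isBalanced_settled_add_one_iff.2 hy).isPackingVector
    · have hy'_add_one := isBalanced_settled_add_one_iff.2 hy'
      dsimp only at h
      exact (isBalanced_settled_add_one_iff.2 hy).unique (h ▸ hy'_add_one)
    · obtain ⟨y, hy⟩ := IsPackingVector.exists_isBalanced (S := univ) hf.1 (by simpa using hf.2) w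
      obtain rfl := hy.eq_settled_add_one hw
      exact ⟨y, isBalanced_settled_add_one_iff.1 hy, rfl⟩
  have h_matching : Set.BijOn (contested N w) Y {S | ∃ σ : B ≃ S, ∀ b, N (σ b) b} := by
    refine ⟨fun y hy => ?_, fun y hy y' hy' h => ?_, fun S ⟨σ, hσ⟩ => ?_⟩
    · exact (isPackingVector_one_iff_exists_equiv (hy.card_contested hw)).1 hy.isPackingVector
    · exact IsBalanced.unique hy (h ▸ hy')
    · have hS : #S = Fintype.card B := by simpa using (Fintype.card_congr σ).symm
      obtain ⟨y, hy⟩ := IsPackingVector.exists_isBalanced (f := 1) (fun _ => Nat.one_pos)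
        ((isPackingVector_one_iff_exists_equiv hS).2 ⟨σ, hσ⟩) w
      obtain rfl := hy.eq_contested hS hw
      exact ⟨y, hy, rfl⟩
  exact h_packing.ncard_eq.symm.trans h_matching.ncard_eq

end GenericCosts

section Supports

open scoped Classical

variable {A B ε : Type*} {N : A → ε → Prop} {r : ε}

/-- The relation `N` contains the graph of a bijection from `T` to `S`. -/
def IsMatchable (N : A → B → Prop) (S : Finset A) (T : Finset B) : Prop :=
  ∃ σ : T ≃ S, ∀ t : T, N (σ t) t

theorem sum_fiberCount [Finite A] [Fintype ε] (φ : A → ε) : ∑ e, fiberCount φ e = Nat.card A := by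
  have := Fintype.ofFinite A
  rw [Nat.card_eq_fintype_card, ← Finset.card_univ,
    Finset.card_eq_sum_card_fiberwise fun v _ => Finset.mem_coe.2 (Finset.mem_univ (φ v))]
  simp [fiberCount, Set.ncard_eq_toFinset_card']

theorem eq_of_mem_fiberCounts_of_eq_off [Finite A] [Finite ε] {f f' : ε → ℕ}
    (hf : f ∈ fiberCounts N) (hf' : f' ∈ fiberCounts N) (h : ∀ e, e ≠ r → f e = f' e) :
    f = f' := by
  have := Fintype.ofFinite ε
  obtain ⟨φ, -, rfl⟩ := hf
  obtain ⟨φ', -, rfl⟩ := hf'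
  have h_sum := (sum_fiberCount φ).trans (sum_fiberCount φ').symm
  rw [Fintype.sum_eq_add_sum_compl r, Fintype.sum_eq_add_sum_compl r,
    Finset.sum_congr rfl fun e he => h e (by simpa using he)] at h_sum
  funext e
  rcases eq_or_ne e r with rfl | he
  · exact Nat.add_right_cancel h_sum
  · exact h e he

theorem isPackingVector_of_mem_fiberCounts [Finite A] (T : Finset {e // e ≠ r}) {f : ε → ℕ}
    (hf : f ∈ fiberCounts N) : IsPackingVector (fun v (t : T) => N v t) fun t => f t := by
  have := Fintype.ofFinite A
  obtain ⟨φ, hφ, rfl⟩ := hf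
  refine ⟨fun t => {v | φ v = t}, fun t t' hne => ?_, fun t v hv => ?_, fun t => ?_⟩
  · refine Finset.disjoint_filter.2 fun v _ hv hv' => hne ?_
    exact Subtype.ext (Subtype.ext (hv.symm.trans hv'))
  · simpa [(Finset.mem_filter.1 hv).2] using hφ v
  · simp [fiberCount, Set.ncard_eq_toFinset_card']

theorem exists_mem_fiberCounts_of_isPackingVector [Finite A] (hr : ∀ v, N v r)
    {T : Finset {e // e ≠ r}} {g : T → ℕ} (hg : IsPackingVector (fun v (t : T) => N v t) g) :
    ∃ f ∈ fiberCounts N, (∀ t : T, f t = g t) ∧ ∀ e : {e // e ≠ r}, e ∉ T → f e = 0 := by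
  obtain ⟨C, h_disjoint, hC, hcard⟩ := hg
  let φ (v : A) : ε := if h : ∃ t, v ∈ C t then h.choose else r
  have hφ_mem {t : T} {v : A} (hv : v ∈ C t) : φ v = t := by
    have h : ∃ t, v ∈ C t := ⟨t, hv⟩
    have : h.choose = t := by
      by_contra hne
      exact Finset.disjoint_left.1 (h_disjoint hne) h.choose_spec hv
    exact (dif_pos h).trans (by rw [this])
  have hφ_eq {v : A} {e : ε} (he : e ≠ r) (hv : φ v = e) : ∃ t : T, v ∈ C t ∧ e = t := by
    by_cases h : ∃ t, v ∈ C t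
    · obtain ⟨t, ht⟩ := h
      exact ⟨t, ht, hv ▸ hφ_mem ht⟩
    · exact absurd ((dif_neg h).symm.trans hv).symm he
  refine ⟨fiberCount φ, ⟨φ, fun v => ?_, rfl⟩, fun t => ?_, fun e he => ?_⟩
  · rcases eq_or_ne (φ v) r with hv | hv
    · exact hv ▸ hr v
    · obtain ⟨t, ht, heq⟩ := hφ_eq hv rfl
      exact heq ▸ hC t v ht
  · rw [fiberCount, ← hcard, ← Set.ncard_coe_finset]
    congr 1
    ext v
    refine ⟨fun hv => ?_, hφ_mem⟩
    obtain ⟨t', ht', heq⟩ := hφ_eq t.1.2 hv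
    exact Subtype.ext (Subtype.ext heq) ▸ ht'
  · refine (Set.ncard_eq_zero).2 (Set.eq_empty_of_forall_notMem fun v hv => ?_)
    obtain ⟨t, -, heq⟩ := hφ_eq e.2 hv
    exact he (Subtype.ext heq ▸ t.2)

theorem ncard_fiberCounts_support_eq [Finite A] [Finite ε] (hr : ∀ v, N v r)
    (T : Finset {e // e ≠ r}) :
    {f ∈ fiberCounts N | ∀ e : {e // e ≠ r}, f e ≠ 0 ↔ e ∈ T}.ncard =
      {S | IsMatchable (fun v (e : {e // e ≠ r}) => N v e) S T}.ncard := by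
  trans {g : T → ℕ | (∀ t, 0 < g t) ∧ IsPackingVector (fun v (t : T) => N v t) g}.ncard
  · refine Set.BijOn.ncard_eq (f := fun (f : ε → ℕ) (t : T) => f t)
      ⟨fun f ⟨hf, hT⟩ => ⟨fun t => ?_, ?_⟩, ?_, ?_⟩
    · exact Nat.pos_of_ne_zero ((hT t).2 t.2)
    · exact isPackingVector_of_mem_fiberCounts T hf
    · rintro f ⟨hf, hT⟩ f' ⟨hf', hT'⟩ h
      refine eq_of_mem_fiberCounts_of_eq_off (r := r) hf hf' fun e he => ?_
      by_cases heT : ⟨e, he⟩ ∈ T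
      · exact congrFun h ⟨_, heT⟩
      · have h_zero : f e = 0 := not_not.1 fun h => heT ((hT ⟨e, he⟩).1 h)
        have h_zero' : f' e = 0 := not_not.1 fun h => heT ((hT' ⟨e, he⟩).1 h)
        rw [h_zero, h_zero']
    · rintro g ⟨hg_pos, hg⟩
      obtain ⟨f, hf, hfg, hf_zero⟩ := exists_mem_fiberCounts_of_isPackingVector hr hg
      refine ⟨f, ⟨hf, fun e => ⟨fun he => not_not.1 fun heT => he (hf_zero e heT), fun he => ?_⟩⟩,
        funext hfg⟩
      exact hfg ⟨e, he⟩ ▸ (hg_pos ⟨e, he⟩).ne'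
  · exact ncard_isPackingVector_pos_eq_ncard_exists_equiv _

theorem sum_X_pow_ncard_support_fiberCounts [Finite A] [Fintype ε] (hr : ∀ v, N v r)
    {P : Set (ε → ℕ)} (hP : P.Finite) (hPN : P = fiberCounts N) :
    ∑ f ∈ hP.toFinset, (X : ℤ[X]) ^ {e | e ≠ r ∧ f e ≠ 0}.ncard =
      ∑ T : Finset {e // e ≠ r},
        C ({S | IsMatchable (fun v (e : {e // e ≠ r}) => N v e) S T}.ncard : ℤ) * X ^ T.card := by
  let support (f : ε → ℕ) : Finset {e // e ≠ r} := {e | f e ≠ 0}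
  rw [← Finset.sum_fiberwise_of_maps_to (g := support) (t := Finset.univ) fun _ _ => by simp]
  refine Finset.sum_congr rfl fun T _ => ?_
  have h_card (f : ε → ℕ) : {e | e ≠ r ∧ f e ≠ 0}.ncard = (support f).card := by
    rw [← Set.ncard_coe_finset, ← Set.ncard_image_of_injective _ Subtype.val_injective]
    congr 1
    ext e
    simp [support, and_comm]
  have h_fiber : ({f ∈ hP.toFinset | support f = T} : Set (ε → ℕ)) =
      {f ∈ fiberCounts N | ∀ e : {e // e ≠ r}, f e ≠ 0 ↔ e ∈ T} := by
    ext f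
    simp [support, Finset.ext_iff, hPN]
  rw [Finset.sum_congr rfl fun f hf => by rw [h_card, (Finset.mem_filter.1 hf).2], Finset.sum_const,
    ← ncard_fiberCounts_support_eq hr, ← h_fiber, ← Set.ncard_coe_finset]
  simp

end Supports

section Matchings

open scoped Classical

variable {V A B : Type*} {G : SimpleGraph V} {V₁ V₂ : Set V} {a : A → V} {b : B → V}

theorem ncard_edgeSet_of_isMatching {M : G.Subgraph} (hM : M.IsMatching)
    (hG : G.IsBipartiteWith V₁ V₂) : M.edgeSet.ncard = (M.verts ∩ V₂).ncard := by
  choose! m hm using fun x (hx : x ∈ M.verts) => (hM hx).exists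
  refine (Set.ncard_congr (fun x _ => s(x, m x)) (fun x hx => hm x hx.1)
    (fun x y hx hy h => ?_) ?_).symm
  · rcases Sym2.eq_iff.1 h with h | h
    · exact h.1
    · exact (hG.symm.disjoint.notMem_of_mem_left hy.2
        (hG.symm.mem_of_mem_adj hx.2 (h.2 ▸ (hm x hx.1).adj_sub))).elim
  · rintro ⟨x, y⟩ (hxy : M.Adj x y)
    rcases hG.mem_of_adj hxy.adj_sub with ⟨-, hy⟩ | ⟨hx, -⟩
    · refine ⟨y, ⟨hxy.snd_mem, hy⟩, ?_⟩
      rw [hM.eq_of_adj_left (hm y hxy.snd_mem) hxy.symm]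
      exact Sym2.eq_swap
    · refine ⟨x, ⟨hxy.fst_mem, hx⟩, ?_⟩
      rw [hM.eq_of_adj_left (hm x hxy.fst_mem) hxy]

theorem apply_mem_image_union_image_iff (ha : Function.Injective a)
    (hab : Disjoint (Set.range a) (Set.range b)) {S : Set A} {T : Set B} {v : A} :
    a v ∈ a '' S ∪ b '' T ↔ v ∈ S := by
  have h_not_mem : a v ∉ b '' T := fun h =>
    hab.notMem_of_mem_left (Set.mem_range_self v) (Set.image_subset_range b T h)
  rw [Set.mem_union, or_iff_left h_not_mem, ha.mem_set_image]

theorem exists_isMatching_of_isMatchable (ha : Function.Injective a) (hb : Function.Injective b)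
    (hab : Disjoint (Set.range a) (Set.range b)) {S : Finset A} {T : Finset B}
    (hST : IsMatchable (fun v e => G.Adj (a v) (b e)) S T) :
    ∃ M : G.Subgraph, M.IsMatching ∧ M.verts = a '' S ∪ b '' T := by
  obtain ⟨σ, hσ⟩ := hST
  have h_disjoint : Disjoint (b '' T) (a '' S) :=
    hab.symm.mono (Set.image_subset_range b T) (Set.image_subset_range a S)
  let eT : T ≃ b '' T := Equiv.Set.image b T hb
  let eS : S ≃ a '' S := Equiv.Set.image a S ha
  obtain ⟨M, hverts, hM⟩ := SimpleGraph.Subgraph.IsMatching.exists_of_disjoint_sets_of_equiv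
    (G := G) h_disjoint ((eT.symm.trans σ).trans eS) fun x => by
      obtain ⟨t, rfl⟩ := eT.surjective x
      rw [Equiv.trans_apply, Equiv.trans_apply, eT.symm_apply_apply]
      exact (hσ t).symm
  exact ⟨M, hM, hverts.trans (Set.union_comm _ _)⟩

theorem isMatchable_of_isMatching (ha : Function.Injective a) (hb : Function.Injective b)
    (hG : G.IsBipartiteWith (Set.range a) (Set.range b)) {M : G.Subgraph} (hM : M.IsMatching)
    {S : Finset A} {T : Finset B} (hverts : M.verts = a '' S ∪ b '' T) :
    IsMatchable (fun v e => G.Adj (a v) (b e)) S T := by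
  have hS (v : A) : a v ∈ M.verts ↔ v ∈ S := by
    rw [hverts, apply_mem_image_union_image_iff ha hG.disjoint, Finset.mem_coe]
  have hT (e : B) : b e ∈ M.verts ↔ e ∈ T := by
    rw [hverts, Set.union_comm, apply_mem_image_union_image_iff hb hG.disjoint.symm, Finset.mem_coe]
  have h_partner (t : T) : ∃ v : S, M.Adj (a v) (b t) := by
    obtain ⟨y, hy, -⟩ := hM ((hT t).2 t.2)
    obtain ⟨v, rfl⟩ := hG.symm.mem_of_mem_adj (Set.mem_range_self t.1) hy.adj_sub
    exact ⟨⟨v, (hS v).1 hy.snd_mem⟩, hy.symm⟩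
  choose σ hσ using h_partner
  have h_bij : Function.Bijective σ := by
    constructor
    · intro t t' h
      exact Subtype.ext (hb (hM.eq_of_adj_left (hσ t) (h ▸ hσ t')))
    · intro v
      obtain ⟨y, hy, -⟩ := hM ((hS v).2 v.2)
      obtain ⟨e, rfl⟩ := hG.mem_of_mem_adj (Set.mem_range_self v.1) hy.adj_sub
      have he : e ∈ T := (hT e).1 hy.snd_mem
      exact ⟨⟨e, he⟩, Subtype.ext (ha (hM.eq_of_adj_right (hσ ⟨e, he⟩) hy))⟩
  exact ⟨.ofBijective σ h_bij, fun t => (hσ t).adj_sub⟩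

theorem exists_verts_eq_image_union_image [Finite A] [Finite B]
    (hG : G.IsBipartiteWith (Set.range a) (Set.range b)) {M : G.Subgraph} (hM : M.IsMatching) :
    ∃ (S : Finset A) (T : Finset B), M.verts = a '' S ∪ b '' T := by
  have h_range : M.verts ⊆ Set.range a ∪ Set.range b := fun x hx => by
    obtain ⟨y, hy, -⟩ := hM hx
    exact (hG.mem_of_adj hy.adj_sub).imp And.left And.left
  refine ⟨(Set.toFinite (a ⁻¹' M.verts)).toFinset, (Set.toFinite (b ⁻¹' M.verts)).toFinset, ?_⟩
  rw [Set.Finite.coe_toFinset, Set.Finite.coe_toFinset, Set.image_preimage_eq_inter_range,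
    Set.image_preimage_eq_inter_range, ← Set.inter_union_distrib_left,
    Set.inter_eq_left.2 h_range]

theorem ncard_edgeSet_of_verts_eq (hb : Function.Injective b)
    (hG : G.IsBipartiteWith (Set.range a) (Set.range b)) {M : G.Subgraph} (hM : M.IsMatching)
    {S : Set A} {T : Finset B} (hverts : M.verts = a '' S ∪ b '' T) :
    M.edgeSet.ncard = T.card := by
  have h_inter : M.verts ∩ Set.range b = b '' T := by
    ext x
    refine ⟨?_, fun hx => ⟨hverts ▸ .inr hx, Set.image_subset_range b T hx⟩⟩
    rintro ⟨hx, e, rfl⟩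
    rw [hverts, Set.union_comm, apply_mem_image_union_image_iff hb hG.disjoint.symm] at hx
    exact Set.mem_image_of_mem b hx
  rw [ncard_edgeSet_of_isMatching hM hG, h_inter, Set.ncard_image_of_injective _ hb,
    Set.ncard_coe_finset]

theorem ncard_matchingVertexSets [Finite A] [Fintype B] (ha : Function.Injective a)
    (hb : Function.Injective b) (hG : G.IsBipartiteWith (Set.range a) (Set.range b))
    (k : ℕ) :
    (matchingVertexSets G k).ncard = ∑ T : Finset B with T.card = k,
      {S | IsMatchable (fun v e => G.Adj (a v) (b e)) S T}.ncard := by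
  cases nonempty_fintype A
  let matchable (T : Finset B) : Finset (Finset A) :=
    {S | IsMatchable (fun v e => G.Adj (a v) (b e)) S T}
  have h_bij : Set.BijOn (fun p : Σ _ : Finset B, Finset A => a '' p.2 ∪ b '' p.1)
      (({T | T.card = k} : Finset (Finset B)).sigma matchable) (matchingVertexSets G k) := by
    refine ⟨?_, ?_, ?_⟩
    · rintro ⟨T, S⟩ hp
      obtain ⟨hT, hS⟩ : T.card = k ∧ _ := by simpa [matchable] using hp
      obtain ⟨M, hM, hverts⟩ := exists_isMatching_of_isMatchable ha hb hG.disjoint hS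
      exact ⟨M, hM, (ncard_edgeSet_of_verts_eq hb hG hM hverts).trans hT, hverts⟩
    · rintro ⟨T, S⟩ - ⟨T', S'⟩ - h
      have hS : S = S' := Finset.ext fun v => by
        simpa [apply_mem_image_union_image_iff ha hG.disjoint] using congrArg (a v ∈ ·) h
      have hT : T = T' := Finset.ext fun e => by
        simpa [Set.union_comm (a '' _), apply_mem_image_union_image_iff hb hG.disjoint.symm]
          using congrArg (b e ∈ ·) h
      rw [hS, hT]
    · rintro _ ⟨M, hM, rfl, rfl⟩
      obtain ⟨S, T, hverts⟩ := exists_verts_eq_image_union_image hG hM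
      have hST := isMatchable_of_isMatching ha hb hG hM hverts
      have h_card := ncard_edgeSet_of_verts_eq hb hG hM hverts
      exact ⟨⟨T, S⟩, by simp [matchable, h_card, hST], hverts.symm⟩
  rw [← h_bij.ncard_eq, Set.ncard_coe_finset, Finset.card_sigma]
  exact Finset.sum_congr rfl fun T _ => by simp [← Set.ncard_coe_finset, matchable]

end Matchings

section HatGraph

variable {V : Type*} {G : SimpleGraph V} {V₁ V₂ : Set V}

theorem hatGraph_adj_inl_inl {x y : V} :
    (hatGraph G V₁ V₂).Adj (Sum.inl x) (Sum.inl y) ↔ G.Adj x y := by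
  have h_exists : (∃ u w, G.Adj u w ∧ (u = x ∧ w = y ∨ u = y ∧ w = x)) ↔ G.Adj x y := by
    grind [G.adj_comm]
  have h_ne : G.Adj x y → x ≠ y := SimpleGraph.Adj.ne
  simpa [hatGraph, Sym2.exists, h_exists] using h_ne

theorem hatGraph_adj_inl_inr_zero {x : V} :
    (hatGraph G V₁ V₂).Adj (Sum.inl x) (Sum.inr 0) ↔ x ∈ V₁ := by
  simp [hatGraph, Sym2.exists]

theorem hatGraph_adj_inl_inr_one {x : V} :
    (hatGraph G V₁ V₂).Adj (Sum.inl x) (Sum.inr 1) ↔ x ∈ V₂ := by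
  simp [hatGraph, Sym2.exists]

theorem hatGraph_adj_inr_zero_inr_one : (hatGraph G V₁ V₂).Adj (Sum.inr 0) (Sum.inr 1) := by
  simp [hatGraph, Sym2.exists]

/-- Interchanging the two parts of `G` interchanges the two new vertices of `Ĝ`. -/
def hatGraphSwap (G : SimpleGraph V) (V₁ V₂ : Set V) : hatGraph G V₁ V₂ ≃g hatGraph G V₂ V₁ where
  toEquiv := Equiv.sumCongr (Equiv.refl V) (Equiv.swap 0 1)
  map_rel_iff' := by
    rintro (x | i) (y | j)
    · exact hatGraph_adj_inl_inl.trans hatGraph_adj_inl_inl.symm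
    · fin_cases j <;> simp [hatGraph_adj_inl_inr_zero, hatGraph_adj_inl_inr_one]
    · fin_cases i <;> simp [SimpleGraph.adj_comm _ (Sum.inr _), hatGraph_adj_inl_inr_zero,
        hatGraph_adj_inl_inr_one]
    · fin_cases i <;> fin_cases j <;>
        simp [hatGraph_adj_inr_zero_inr_one, hatGraph_adj_inr_zero_inr_one.symm]

end HatGraph

section Labelling

variable {V α ε : Type*} {G : SimpleGraph V} {V₁ V₂ : Set V} {H : MultiHypergraph α ε}
  {ψ : H.bip ≃g hatGraph G V₁ V₂} {s : α} {r : ε}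

theorem exists_equiv_apply_eq_inl {X W : Type*} {f : X → V ⊕ W} {S : Set V}
    (hf : Function.Injective f) (hS : Set.range f = Sum.inl '' S) :
    ∃ a : X ≃ S, ∀ x, f x = Sum.inl (a x).1 := by
  have h_mem (x : X) : ∃ y : S, f x = Sum.inl y.1 := by
    obtain ⟨y, hy, hyx⟩ := hS.subset (Set.mem_range_self x)
    exact ⟨⟨y, hy⟩, hyx.symm⟩
  choose a ha using h_mem
  refine ⟨.ofBijective a ⟨fun x x' h => hf (by rw [ha, ha, h]), fun y => ?_⟩, ha⟩
  obtain ⟨x, hx⟩ := hS.superset (Set.mem_image_of_mem Sum.inl y.2)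
  exact ⟨x, Subtype.ext (Sum.inl_injective ((ha x).symm.trans hx))⟩

namespace MultiHypergraph

theorem exists_inl_of_mem_left (hr : ψ (Sum.inr r) = Sum.inr 0) {x : V} (hx : x ∈ V₁) :
    ∃ v, ψ (Sum.inl v) = Sum.inl x := by
  obtain ⟨v | e, hy⟩ := ψ.surjective (Sum.inl x)
  · exact ⟨v, hy⟩
  · rw [← hatGraph_adj_inl_inr_zero (G := G) (V₂ := V₂), ← hy, ← hr, ψ.map_adj_iff] at hx
    exact absurd hx not_bip_adj_inr_inr

theorem exists_inr_of_mem_right (hs : ψ (Sum.inl s) = Sum.inr 1) {x : V} (hx : x ∈ V₂) :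
    ∃ e, ψ (Sum.inr e) = Sum.inl x := by
  obtain ⟨v | e, hy⟩ := ψ.surjective (Sum.inl x)
  · rw [← hatGraph_adj_inl_inr_one (G := G) (V₁ := V₁), ← hy, ← hs, ψ.map_adj_iff] at hx
    exact absurd hx not_bip_adj_inl_inl
  · exact ⟨e, hy⟩

theorem exists_vertex_labelling (hV : V₁ ∪ V₂ = Set.univ) (hr : ψ (Sum.inr r) = Sum.inr 0)
    (hs : ψ (Sum.inl s) = Sum.inr 1) :
    ∃ a : {v // v ≠ s} ≃ V₁, ∀ v, ψ (Sum.inl v.1) = Sum.inl (a v).1 := by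
  refine exists_equiv_apply_eq_inl
    (ψ.injective.comp (Sum.inl_injective.comp Subtype.val_injective)) (Set.ext fun y => ⟨?_, ?_⟩)
  · rintro ⟨⟨v, hv⟩, rfl⟩
    change ψ (Sum.inl v) ∈ _
    rcases h : ψ (Sum.inl v) with x | i
    · refine ⟨x, (hV.superset (Set.mem_univ x)).resolve_right fun hx => ?_, rfl⟩
      obtain ⟨e, he⟩ := exists_inr_of_mem_right hs hx
      exact Sum.inl_ne_inr (ψ.injective (h.trans he.symm))
    · fin_cases i
      · exact (Sum.inl_ne_inr (ψ.injective (h.trans hr.symm))).elim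
      · exact (hv (Sum.inl_injective (ψ.injective (h.trans hs.symm)))).elim
  · rintro ⟨x, hx, rfl⟩
    obtain ⟨v, hv⟩ := exists_inl_of_mem_left hr hx
    exact ⟨⟨v, by rintro rfl; simp_all⟩, hv⟩

theorem exists_hyperedge_labelling (hV : V₁ ∪ V₂ = Set.univ) (hr : ψ (Sum.inr r) = Sum.inr 0)
    (hs : ψ (Sum.inl s) = Sum.inr 1) :
    ∃ b : {e // e ≠ r} ≃ V₂, ∀ e, ψ (Sum.inr e.1) = Sum.inl (b e).1 := by
  refine exists_equiv_apply_eq_inl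
    (ψ.injective.comp (Sum.inr_injective.comp Subtype.val_injective)) (Set.ext fun y => ⟨?_, ?_⟩)
  · rintro ⟨⟨e, he⟩, rfl⟩
    change ψ (Sum.inr e) ∈ _
    rcases h : ψ (Sum.inr e) with x | i
    · refine ⟨x, (hV.superset (Set.mem_univ x)).resolve_left fun hx => ?_, rfl⟩
      obtain ⟨v, hv⟩ := exists_inl_of_mem_left hr hx
      exact Sum.inl_ne_inr (ψ.injective (hv.trans h.symm))
    · fin_cases i
      · exact (he (Sum.inr_injective (ψ.injective (h.trans hr.symm)))).elim
      · exact (Sum.inr_ne_inl (ψ.injective (h.trans hs.symm))).elim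
  · rintro ⟨x, hx, rfl⟩
    obtain ⟨e, he⟩ := exists_inr_of_mem_right hs hx
    exact ⟨⟨e, by rintro rfl; simp_all⟩, he⟩

theorem exists_apply_inl_eq_inr_one (hr : ψ (Sum.inr r) = Sum.inr 0) :
    ∃ s, ψ (Sum.inl s) = Sum.inr 1 := by
  obtain ⟨s | e, hy⟩ := ψ.surjective (Sum.inr 1)
  · exact ⟨s, hy⟩
  · have h_adj := hatGraph_adj_inr_zero_inr_one (G := G) (V₁ := V₁) (V₂ := V₂)
    rw [← hr, ← hy, ψ.map_adj_iff] at h_adj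
    exact absurd h_adj not_bip_adj_inr_inr

theorem exists_labelling (hV : V₁ ∪ V₂ = Set.univ) (hr : ψ (Sum.inr r) = Sum.inr 0) :
    ∃ s : α, (∀ e, s ∈ H.edge e) ∧ (∀ v, v ∈ H.edge r) ∧
      ∃ (a : {v // v ≠ s} ≃ V₁) (b : {e // e ≠ r} ≃ V₂),
        ∀ v e, v.1 ∈ H.edge e.1 ↔ G.Adj (a v) (b e) := by
  obtain ⟨s, hs⟩ := exists_apply_inl_eq_inr_one hr
  obtain ⟨a, ha⟩ := exists_vertex_labelling hV hr hs
  obtain ⟨b, hb⟩ := exists_hyperedge_labelling hV hr hs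
  have h_mem_edge (v : α) (e : ε) :
      v ∈ H.edge e ↔ (hatGraph G V₁ V₂).Adj (ψ (Sum.inl v)) (ψ (Sum.inr e)) := by
    rw [ψ.map_adj_iff, bip_adj_inl_inr]
  have h_root : s ∈ H.edge r := by
    rw [h_mem_edge, hs, hr]
    exact hatGraph_adj_inr_zero_inr_one.symm
  refine ⟨s, fun e => ?_, fun v => ?_, a, b, fun v e => ?_⟩
  · rcases eq_or_ne e r with rfl | he
    · exact h_root
    · rw [h_mem_edge, hs, hb ⟨e, he⟩, SimpleGraph.adj_comm]
      exact hatGraph_adj_inl_inr_one.2 (b ⟨e, he⟩).2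
  · rcases eq_or_ne v s with rfl | hv
    · exact h_root
    · rw [h_mem_edge, hr, ha ⟨v, hv⟩]
      exact hatGraph_adj_inl_inr_zero.2 (a ⟨v, hv⟩).2
  · rw [h_mem_edge, ha, hb, hatGraph_adj_inl_inl]

end MultiHypergraph

end Labelling

theorem MultiHypergraph.interiorPolynomial_eq_of_apply_inr_eq {V α ε : Type*} [Fintype V] [Finite α]
    [Finite ε] [LinearOrder ε] {G : SimpleGraph V} {V₁ V₂ : Set V} {H : MultiHypergraph α ε}
    (hG : G.IsBipartiteWith V₁ V₂) (hV : V₁ ∪ V₂ = Set.univ) (ψ : H.bip ≃g hatGraph G V₁ V₂)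
    {r : ε} (hr : ψ (Sum.inr r) = Sum.inr 0) :
    H.interiorPolynomial =
      ∑ k ∈ Finset.range (Fintype.card V + 1),
        C ((matchingVertexSets G k).ncard : ℤ) * X ^ k := by
  classical
  cases nonempty_fintype ε
  obtain ⟨s, hs, hr_all, a, b, hab⟩ := exists_labelling hV hr
  have ha : Function.Injective (Subtype.val ∘ a) := Subtype.val_injective.comp a.injective
  have hb : Function.Injective (Subtype.val ∘ b) := Subtype.val_injective.comp b.injective
  have hG_range : G.IsBipartiteWith (Set.range (Subtype.val ∘ a))
      (Set.range (Subtype.val ∘ b)) := by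
    rwa [EquivLike.range_comp, EquivLike.range_comp, Subtype.range_coe, Subtype.range_coe]
  have h_card_le (T : Finset {e // e ≠ r}) : T.card ≤ Fintype.card V :=
    T.card_le_univ.trans (Fintype.card_le_of_injective _ hb)
  rw [interiorPolynomial_eq_sum_support hs hr_all,
    sum_X_pow_ncard_support_fiberCounts (N := H.unrootedIncidence s) (fun v => hr_all v) _
      (hypertrees_eq_fiberCounts hs),
    ← Finset.sum_fiberwise_of_maps_to (g := Finset.card)
      fun T _ => Finset.mem_range_succ_iff.2 (h_card_le T)]
  refine Finset.sum_congr rfl fun k _ => ?_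
  rw [ncard_matchingVertexSets ha hb hG_range, Nat.cast_sum, map_sum, Finset.sum_mul]
  refine Finset.sum_congr (by ext; simp) fun T hT => ?_
  simp only [unrootedIncidence, hab, Function.comp_apply, (Finset.mem_filter.1 hT).2]

/-- The interior polynomial of `Ĝ` is computed from any hypergraph `H` with `Bip H ≅ Ĝ`, and with
any ordering of its hyperedges. No `k`-matching exists for `k` greater than the number of
vertices, so the sum is the sum over all `k ≥ 0`. -/
theorem proposition3p3 {V : Type*} [Fintype V] (G : SimpleGraph V) (V₁ V₂ : Set V)
    (hG : G.IsBipartiteWith V₁ V₂) (hV : V₁ ∪ V₂ = Set.univ)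
    {α ε : Type*} [Finite α] [Finite ε] [LinearOrder ε] (H : MultiHypergraph α ε)
    (hH : Nonempty (H.bip ≃g hatGraph G V₁ V₂)) :
    H.interiorPolynomial =
      ∑ k ∈ Finset.range (Fintype.card V + 1), C ((matchingVertexSets G k).ncard : ℤ) * X ^ k := by
  obtain ⟨ψ⟩ := hH
  obtain ⟨v | r, hr⟩ := ψ.surjective (Sum.inr 0)
  · obtain ⟨w | r, hr'⟩ := ψ.surjective (Sum.inr 1)
    · have h_adj := hatGraph_adj_inr_zero_inr_one (G := G) (V₁ := V₁) (V₂ := V₂)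
      rw [← hr, ← hr', ψ.map_adj_iff] at h_adj
      exact absurd h_adj MultiHypergraph.not_bip_adj_inl_inl
    · refine MultiHypergraph.interiorPolynomial_eq_of_apply_inr_eq hG.symm
        (by rwa [Set.union_comm]) (ψ.trans (hatGraphSwap G V₁ V₂)) (r := r) ?_
      simp [hatGraphSwap, hr']
  · exact MultiHypergraph.interiorPolynomial_eq_of_apply_inr_eq hG hV ψ hr
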